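/- Let $d\ge 1$ and $\ell$ be natural numbers, let $0<\alpha<d$, $p=\frac{d}{d-\alpha}$ and $\beta\in(0,1)$. Let $K\colon\mathbb{R}^d\to\mathbb{R}^\ell$ be positively $(\alpha-d)$-homogeneous, i.e. $K(\lambda x)=\lambda^{\alpha-d}K(x)$ for all $\lambda>0$ and $x\neq 0$, and let $\Phi\colon\mathbb{R}^\ell\to\mathbb{R}$ be positively $p$-homogeneous, i.e. $\Phi(\lambda y)=\lambda^p\Phi(y)$ for all $\lambda>0$ and $y\in\mathbb{R}^\ell$. Assume that $K$ and $\Phi$ are Lipschitz on the unit spheres of $\mathbb{R}^d$ and $\mathbb{R}^\ell$, respectively. Let $\Omega\subset\mathbb{R}^d$ be a bounded open set (not necessarily connected) with $C^{1,\beta}$-smooth boundary: in a neighborhood of any point of $\partial\Omega$, in suitable orthonormal coordinates, $\Omega$ is the set of points lying strictly on one side of the graph of a differentiable function of $d-1$ variables whose gradient is $\beta$-Hölder. Assume that for every $\xi\in S^{d-1}$ $$\int_{\zeta\in S^{d-1},\ \langle\zeta,\xi\rangle>0}\Phi(K(\zeta))\,d\sigma(\zeta)=0\quad\text{and}\quad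 \int_{\zeta\in S^{d-1},\ \langle\zeta,\xi\rangle>0}\Phi(-K(\zeta))\,d\sigma(\zeta)=0,$$ where $\sigma$ is the $(d-1)$-dimensional Hausdorff measure on the unit sphere $S^{d-1}$. For $n\in\mathbb{Z}$ let $K_n(x)=K(x)$ if $|x|\in[2^{-n-1},2^{-n})$ and $K_n(x)=0$ otherwise. Then there is a constant $C$ (depending on $d,\ell,\alpha,\beta,K,\Phi,\Omega$, but not on $f$) such that for every bounded compactly supported function $f\colon\mathbb{R}^d\to\mathbb{R}$ the functions $\Phi(K_n*f)$, $n\in\mathbb{Z}$, are integrable over $\Omega$ and $$\sum_{n\in\mathbb{Z}}\Big|\int_\Omega\Phi\big(K_n*f(x)\big)\,dx\Big|\le C\,\|f\|_{L_1(\mathbb{R}^d)}^p .$$ -/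

import Mathlib

open MeasureTheory Set Metric
open scoped RealInnerProductSpace NNReal Convolution

noncomputable section

namespace MazyaPhi

/-- `Ψ` is positively `q`-homogeneous on `s`: `Ψ (t y) = t ^ q Ψ y` for all `y ∈ s` and `t > 0`. -/
def PosHomogeneousOn {E F : Type*} [AddCommGroup E] [Module ℝ E] [AddCommGroup F] [Module ℝ F]
    (q : ℝ) (Ψ : E → F) (s : Set E) : Prop :=
  ∀ t : ℝ, 0 < t → ∀ y ∈ s, Ψ (t • y) = t ^ q • Ψ y

/-- `Ψ` is Lipschitz on the unit sphere. -/
def LipschitzOnSphere {E F : Type*} [NormedAddCommGroup E] [NormedAddCommGroup F]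
    (Ψ : E → F) : Prop :=
  ∃ L : ℝ≥0, LipschitzOnWith L Ψ (sphere (0 : E) 1)

/-- The open half-sphere `{ζ : |ζ| = 1, ⟨ζ, ξ⟩ > 0}`. -/
def halfSphere {d : ℕ} (ξ : EuclideanSpace ℝ (Fin d)) : Set (EuclideanSpace ℝ (Fin d)) :=
  {ζ | ζ ∈ sphere (0 : EuclideanSpace ℝ (Fin d)) 1 ∧ 0 < ⟪ζ, ξ⟫}

/-- The half-sphere cancellation condition, with respect to the `(d-1)`-dimensional Hausdorff
measure: the integrals of `Φ (K ζ)` and of `Φ (-K ζ)` over every half-sphere vanish. -/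
def HalfSphereCancellation {d l : ℕ}
    (K : EuclideanSpace ℝ (Fin d) → EuclideanSpace ℝ (Fin l))
    (Φ : EuclideanSpace ℝ (Fin l) → ℝ) : Prop :=
  ∀ ξ ∈ sphere (0 : EuclideanSpace ℝ (Fin d)) 1,
    ∫ ζ in halfSphere ξ, Φ (K ζ) ∂(μH[(d : ℝ) - 1]) = 0 ∧
    ∫ ζ in halfSphere ξ, Φ (-K ζ) ∂(μH[(d : ℝ) - 1]) = 0

/-- The boundary of `Ω` is `C^{1,β}` smooth: near every boundary point `z`, in suitable
orthonormal coordinates (the last axis being directed by a unit vector `ν`, the other ones spanning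
its orthogonal hyperplane), `Ω` is the set of points on one side of the graph of a differentiable
function `h` on the hyperplane whose derivative is `β`-Hölder. -/
def HasC1HolderBoundary {d : ℕ} (β : ℝ≥0) (Ω : Set (EuclideanSpace ℝ (Fin d))) : Prop :=
  ∀ z ∈ frontier Ω, ∃ r : ℝ, 0 < r ∧ ∃ ν : EuclideanSpace ℝ (Fin d), ‖ν‖ = 1 ∧
    ∃ h : (ℝ ∙ ν)ᗮ → ℝ, ∃ C : ℝ≥0,
      (∀ y ∈ ball ((ℝ ∙ ν)ᗮ.orthogonalProjectionOnto z) r, DifferentiableAt ℝ h y) ∧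
      HolderOnWith C β (fderiv ℝ h) (ball ((ℝ ∙ ν)ᗮ.orthogonalProjectionOnto z) r) ∧
      ∀ x ∈ ball z r, x ∈ Ω ↔ h ((ℝ ∙ ν)ᗮ.orthogonalProjectionOnto x) < ⟪ν, x⟫

/-- The restriction `K_n` of `K` to the dyadic annulus `|x| ∈ [2^{-n-1}, 2^{-n})`, extended by
zero. -/
def annulusPart {d l : ℕ} (K : EuclideanSpace ℝ (Fin d) → EuclideanSpace ℝ (Fin l)) (n : ℤ) :
    EuclideanSpace ℝ (Fin d) → EuclideanSpace ℝ (Fin l) :=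
  {x : EuclideanSpace ℝ (Fin d) | ‖x‖ ∈ Ico ((2 : ℝ) ^ (-n - 1)) ((2 : ℝ) ^ (-n))}.indicator K

/-- The convolution `K_n * f (x) = ∫ f(y) K_n(x - y) dy`. -/
def annulusConv {d l : ℕ} (K : EuclideanSpace ℝ (Fin d) → EuclideanSpace ℝ (Fin l)) (n : ℤ)
    (f : EuclideanSpace ℝ (Fin d) → ℝ) :
    EuclideanSpace ℝ (Fin d) → EuclideanSpace ℝ (Fin l) :=
  f ⋆[ContinuousLinearMap.lsmul ℝ ℝ, volume] annulusPart K n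

end MazyaPhi

end

namespace MazyaPhi
open Filter Topology
open scoped ENNReal BoundedContinuousFunction

/-! ### Uniformly distributed measures on a metric space -/

section UniformlyDistributed

variable {X : Type*} [MetricSpace X] [SecondCountableTopology X] [MeasurableSpace X] [BorelSpace X]

/-! By homogeneity one may take `‖f‖₁ = 1` and write `f dx = s μ` with `μ` a probability measure and
`|s| ≤ 1`. Fix a scale `r = 2⁻ⁿ` and put `g = K_n * f`, `V(x) = μ(B(x,2r))`. Since `K_n` lives in
`B(0,r)`, `g` vanishes wherever `V` does, so `∫_Ω Φ(g)` is the `μ`-average over `z` of the local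
energies `∫_{Ω ∩ B(z,2r)} Φ(g)/V` (`enorm_setIntegral_potential_le`).

Near `z`, replace `s μ` by the point mass `σ δ_z`, where `σ = ∫_{B(z,4r)} s dμ`, and `V` by `N =
μ(B(z,4r))`. The local Lipschitz bound on `Φ` and the `L¹` modulus of continuity of `K_n` bound the
error by a constant times `N^(p-2) ∫_{B(z,4r)} |y-z|/r dμ(y)`; the constant is scale-free because
`(α-d)p = -d` (`lintegral_enorm_sub_pointMass_le`). These errors are summable over `n`, uniformly in
`z`: `N` dominates `G(y) = μ(closedBall z |y-z|)`, the factors `|y-z|/r` form a geometric series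
over the scales `r > |y-z|/4`, and `∫ G^(-s) dμ` is bounded for `s < 1` because `μ{G ≤ t} ≤ t`
(`exists_tsum_nonconcentration_le`).

What remains is a multiple, with coefficient at most one, of `∫_Ω Φ(±K_n(x-z)) dx`. In polar
coordinates the cancellation hypothesis says that `Φ(±K_n)` has zero integral over every half-space
through the origin, hence over the whole space. So only scales at which `B(z,r)` meets `∂Ω` matter.
At large scales the bound `|Ω| r^(-d)` is geometric. At small ones, with `δ = dist(z,∂Ω) < r`, `Ω`
differs from a half-space through `z` inside a slab of thickness of order `δ + r^(1+β)`, which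
contributes `δ/r + r^β`, again geometric (`exists_tsum_enorm_setIntegral_translate_le`).

The passage from Hausdorff measure on the sphere to volume rests on Christensen's theorem: two
uniformly distributed measures are proportional. -/

lemma measurableSet_dist_lt (ρ : ℝ) : MeasurableSet {q : X × X | dist q.2 q.1 < ρ} :=
  (isOpen_lt (by fun_prop) (by fun_prop)).measurableSet

lemma lintegral_lintegral_ball {μ ν : Measure X} [SFinite μ] [SFinite ν]
    {φ : X → ℝ≥0∞} (hφ : Measurable φ) (ρ : ℝ) :
    ∫⁻ x, ∫⁻ y in ball x ρ, φ y ∂ν ∂μ = ∫⁻ y, φ y * μ (ball y ρ) ∂ν := by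
  have h1 : ∀ x, ∫⁻ y in ball x ρ, φ y ∂ν
      = ∫⁻ y, ({q : X × X | dist q.2 q.1 < ρ}.indicator (fun q ↦ φ q.2) (x, y)) ∂ν := fun x ↦ by
    rw [← lintegral_indicator measurableSet_ball]
    rfl
  simp_rw [h1]
  rw [lintegral_lintegral_swap]
  · refine lintegral_congr fun y ↦ ?_
    rw [← setLIntegral_const, ← lintegral_indicator measurableSet_ball]
    refine lintegral_congr fun x ↦ ?_
    simp only [indicator, mem_ofPred_eq, mem_ball, dist_comm]
  · exact ((hφ.comp measurable_snd).indicator (measurableSet_dist_lt ρ)).aemeasurable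

omit [SecondCountableTopology X] in
/-- The averages of a continuous function over small balls converge to the function. -/
lemma tendsto_average_ball {ν : Measure X} [IsFiniteMeasure ν] (φ : X →ᵇ ℝ≥0) (x : X)
    (hpos : ∀ ρ, 0 < ρ → ν (ball x ρ) ≠ 0) :
    Tendsto (fun n : ℕ ↦ (ν (ball x (1 / ((n : ℝ) + 1))))⁻¹ *
      ∫⁻ y in ball x (1 / ((n : ℝ) + 1)), φ y ∂ν) atTop (𝓝 (φ x)) := by
  rw [ENNReal.tendsto_nhds ENNReal.coe_ne_top]
  intro ε hε
  by_cases hεt : ε = ⊤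
  · subst hεt; simp
  have hc : Tendsto (fun y ↦ (φ y : ℝ≥0∞)) (𝓝 x) (𝓝 (φ x)) :=
    (ENNReal.continuous_coe.comp φ.continuous).continuousAt
  rw [ENNReal.tendsto_nhds ENNReal.coe_ne_top] at hc
  obtain ⟨δ, hδ, hball⟩ := Metric.eventually_nhds_iff_ball.1 (hc ε hε)
  have hlim : ∀ᶠ n : ℕ in atTop, 1 / ((n : ℝ) + 1) < δ :=
    tendsto_one_div_add_atTop_nhds_zero_nat.eventually (gt_mem_nhds hδ)
  filter_upwards [hlim] with n hn
  set ρ := 1 / ((n : ℝ) + 1)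
  have hρ : 0 < ρ := by positivity
  have h0 := hpos ρ hρ
  have hf : ν (ball x ρ) ≠ ⊤ := measure_ne_top _ _
  have hcomp : ∀ a : ℝ≥0∞, (ν (ball x ρ))⁻¹ * ∫⁻ _ in ball x ρ, a ∂ν = a := fun a ↦ by
    rw [setLIntegral_const, mul_comm a, ← mul_assoc, ENNReal.inv_mul_cancel h0 hf, one_mul]
  constructor
  · rw [← hcomp (φ x - ε)]
    gcongr 1
    exact setLIntegral_mono' measurableSet_ball fun y hy ↦
      (hball y (ball_subset_ball hn.le hy)).1
  · rw [← hcomp (φ x + ε)]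
    gcongr 1
    exact setLIntegral_mono' measurableSet_ball fun y hy ↦
      (hball y (ball_subset_ball hn.le hy)).2

/-- Two finite measures carried by a set `S`, each giving the same mass to all balls of a given
radius centred on `S`, are proportional. -/
theorem eq_smul_of_uniformlyDistributed {μ ν : Measure X} [IsFiniteMeasure μ] [IsFiniteMeasure ν]
    {S : Set X} (hμS : ∀ᵐ x ∂μ, x ∈ S) (hνS : ∀ᵐ x ∂ν, x ∈ S) {g h : ℝ → ℝ≥0∞}
    (hg : ∀ ρ, 0 < ρ → ∀ x ∈ S, μ (ball x ρ) = g ρ)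
    (hh : ∀ ρ, 0 < ρ → ∀ x ∈ S, ν (ball x ρ) = h ρ) (hpos : ∀ ρ, 0 < ρ → h ρ ≠ 0)
    (hS : S.Nonempty) : μ = (μ univ / ν univ) • ν := by
  obtain ⟨x₀, hx₀⟩ := hS
  have hν0 : ν univ ≠ 0 := fun h0 ↦ hpos 1 one_pos <| by
    rw [← hh 1 one_pos x₀ hx₀]; exact measure_mono_null (subset_univ _) h0
  have hht : ∀ ρ, 0 < ρ → h ρ ≠ ⊤ := fun ρ hρ ↦ by
    rw [← hh ρ hρ x₀ hx₀]; exact measure_ne_top _ _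
  -- Tonelli and the symmetry of `dist`: averaging `φ` over `ν`-balls and then integrating against
  -- `μ` gives a multiple of `∫ φ dν` in which only the ball masses `g ρ`, `h ρ` enter.
  have key : ∀ (φ : X → ℝ≥0∞), Measurable φ → ∀ ρ, 0 < ρ →
      ∫⁻ x, (ν (ball x ρ))⁻¹ * ∫⁻ y in ball x ρ, φ y ∂ν ∂μ = g ρ / h ρ * ∫⁻ y, φ y ∂ν := by
    intro φ hφ ρ hρ
    have : ∫⁻ x, (ν (ball x ρ))⁻¹ * ∫⁻ y in ball x ρ, φ y ∂ν ∂μ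
        = ∫⁻ x, (h ρ)⁻¹ * ∫⁻ y in ball x ρ, φ y ∂ν ∂μ :=
      lintegral_congr_ae (hμS.mono fun x hx ↦ by simp only [hh ρ hρ x hx])
    rw [this, lintegral_const_mul' _ _ (ENNReal.inv_ne_top.2 (hpos ρ hρ)),
      lintegral_lintegral_ball hφ]
    have : ∫⁻ y, φ y * μ (ball y ρ) ∂ν = ∫⁻ y, φ y * g ρ ∂ν :=
      lintegral_congr_ae (hνS.mono fun x hx ↦ by simp only [hg ρ hρ x hx])
    rw [this, lintegral_mul_const _ hφ, div_eq_mul_inv]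
    ring
  -- Testing with `φ = 1` shows that the multiple does not depend on `ρ`; letting `ρ → 0` then
  -- recovers `∫ φ dμ` on the left.
  have hratio : ∀ ρ, 0 < ρ → g ρ / h ρ = μ univ / ν univ := by
    intro ρ hρ
    have h1 := key (fun _ ↦ 1) measurable_const ρ hρ
    have h2 : ∫⁻ x, (ν (ball x ρ))⁻¹ * ∫⁻ y in ball x ρ, 1 ∂ν ∂μ = ∫⁻ x, 1 ∂μ :=
      lintegral_congr_ae (hμS.mono fun x hx ↦ by
        simp only [setLIntegral_const, one_mul, hh ρ hρ x hx]
        exact ENNReal.inv_mul_cancel (hpos ρ hρ) (hht ρ hρ))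
    rw [h2] at h1
    simp only [lintegral_const, one_mul] at h1
    rw [h1, mul_div_assoc, ENNReal.div_self hν0 (measure_ne_top _ _), mul_one]
  refine ext_of_forall_lintegral_eq_of_IsFiniteMeasure fun φ ↦ ?_
  have hφm : Measurable fun x ↦ (φ x : ℝ≥0∞) :=
    measurable_coe_nnreal_ennreal.comp φ.continuous.measurable
  have hlim := tendsto_lintegral_of_dominated_convergence (μ := μ)
    (F := fun n : ℕ ↦ fun x ↦ (ν (ball x (1 / ((n : ℝ) + 1))))⁻¹ *
      ∫⁻ y in ball x (1 / ((n : ℝ) + 1)), φ y ∂ν) (f := fun x ↦ (φ x : ℝ≥0∞))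
    (fun _ ↦ (nndist φ 0 : ℝ≥0∞)) ?_ ?_ ?_ ?_
  · rw [lintegral_smul_measure]
    refine tendsto_nhds_unique hlim ?_
    have : ∀ n : ℕ, ∫⁻ x, (ν (ball x (1 / ((n : ℝ) + 1))))⁻¹ *
        ∫⁻ y in ball x (1 / ((n : ℝ) + 1)), φ y ∂ν ∂μ = μ univ / ν univ * ∫⁻ y, φ y ∂ν :=
      fun n ↦ by rw [key _ hφm _ (by positivity), hratio _ (by positivity)]
    simp only [this]
    exact tendsto_const_nhds
  · intro n
    have hm : Measurable fun x ↦ ν (ball x (1 / ((n : ℝ) + 1))) :=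
      measurable_measure_prodMk_left (measurableSet_dist_lt _)
    refine hm.inv.mul ?_
    have : (fun x ↦ ∫⁻ y in ball x (1 / ((n : ℝ) + 1)), φ y ∂ν)
        = fun x ↦ ∫⁻ y, ({q : X × X | dist q.2 q.1 < 1 / ((n : ℝ) + 1)}.indicator
          (fun q ↦ (φ q.2 : ℝ≥0∞)) (x, y)) ∂ν := by
      ext x
      rw [← lintegral_indicator measurableSet_ball]
      rfl
    rw [this]
    exact ((hφm.comp measurable_snd).indicator (measurableSet_dist_lt _)).lintegral_prod_right'
  · intro n
    refine hμS.mono fun x hx ↦ ?_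
    have hρ : (0 : ℝ) < 1 / ((n : ℝ) + 1) := by positivity
    set ρ := 1 / ((n : ℝ) + 1)
    calc (ν (ball x ρ))⁻¹ * ∫⁻ y in ball x ρ, φ y ∂ν
        ≤ (ν (ball x ρ))⁻¹ * ∫⁻ y in ball x ρ, (nndist φ 0 : ℝ≥0∞) ∂ν := by
          gcongr with y
          exact BoundedContinuousFunction.NNReal.upper_bound φ y
      _ = (ν (ball x ρ))⁻¹ * ν (ball x ρ) * nndist φ 0 := by rw [setLIntegral_const]; ring
      _ ≤ 1 * nndist φ 0 := by gcongr; exact ENNReal.inv_mul_le_one _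
      _ = _ := one_mul _
  · simp only [lintegral_const]
    exact ENNReal.mul_ne_top ENNReal.coe_ne_top (measure_ne_top _ _)
  · refine hμS.mono fun x hx ↦ tendsto_average_ball φ x fun ρ hρ ↦ ?_
    rw [hh ρ hρ x hx]
    exact hpos ρ hρ

end UniformlyDistributed

/-! ### Hausdorff measure of the sphere is invariant, positive and finite -/

section Sphere

/-- The reflection in the hyperplane orthogonal to `x - y` exchanges two points of equal norm, so
isometry invariance implies uniform distribution on spheres. -/
lemma measure_ball_eq_of_invariant {E : Type*} [NormedAddCommGroup E] [InnerProductSpace ℝ E]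
    [MeasurableSpace E] [BorelSpace E] {μ : Measure E}
    (h : ∀ e : E ≃ₗᵢ[ℝ] E, MeasurePreserving e μ μ) {x y : E} (hxy : ‖x‖ = ‖y‖) (ρ : ℝ) :
    μ (ball x ρ) = μ (ball y ρ) := by
  set e := ((ℝ ∙ (x - y))ᗮ).reflection
  have he : e x = y := Submodule.reflection_sub hxy
  rw [← (h e).measure_preimage (s := ball y ρ) measurableSet_ball.nullMeasurableSet]
  congr 1
  ext z
  rw [mem_preimage, ← he, mem_ball, mem_ball, e.dist_map]

lemma lipschitzOnWith_normalize {E : Type*} [NormedAddCommGroup E] [NormedSpace ℝ E] :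
    LipschitzOnWith 2 (fun x : E ↦ ‖x‖⁻¹ • x) {x | 1 ≤ ‖x‖} := by
  refine LipschitzOnWith.of_dist_le_mul fun x hx y hy ↦ ?_
  simp only [mem_ofPred_eq] at hx hy
  rw [dist_eq_norm, dist_eq_norm]
  have hx0 : 0 < ‖x‖ := by linarith
  have hy0 : 0 < ‖y‖ := by linarith
  have h1 : ‖x‖⁻¹ • x - ‖y‖⁻¹ • y = ‖x‖⁻¹ • (x - y) + (‖x‖⁻¹ - ‖y‖⁻¹) • y := by
    module
  have h2 : |‖x‖⁻¹ - ‖y‖⁻¹| * ‖y‖ ≤ ‖x - y‖ := by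
    have : ‖x‖⁻¹ - ‖y‖⁻¹ = (‖y‖ - ‖x‖) * (‖x‖⁻¹ * ‖y‖⁻¹) := by field_simp
    rw [this, abs_mul, abs_of_pos (by positivity : 0 < ‖x‖⁻¹ * ‖y‖⁻¹)]
    have h3 := abs_norm_sub_norm_le y x
    rw [norm_sub_rev] at h3
    have h4 : ‖x‖⁻¹ ≤ 1 := inv_le_one_of_one_le₀ hx
    calc |‖y‖ - ‖x‖| * (‖x‖⁻¹ * ‖y‖⁻¹) * ‖y‖ = |‖y‖ - ‖x‖| * ‖x‖⁻¹ := by field_simp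
      _ ≤ ‖x - y‖ * 1 := by gcongr
      _ = _ := mul_one _
  have h5 : ‖x‖⁻¹ * ‖x - y‖ ≤ ‖x - y‖ :=
    mul_le_of_le_one_left (norm_nonneg _) (inv_le_one_of_one_le₀ hx)
  calc _ ≤ ‖‖x‖⁻¹ • (x - y)‖ + ‖(‖x‖⁻¹ - ‖y‖⁻¹) • y‖ := by rw [h1]; exact norm_add_le _ _
    _ = ‖x‖⁻¹ * ‖x - y‖ + |‖x‖⁻¹ - ‖y‖⁻¹| * ‖y‖ := by
      rw [norm_smul, norm_smul, Real.norm_eq_abs, Real.norm_eq_abs, abs_of_pos (inv_pos.2 hx0)]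
    _ ≤ _ := by simp only [NNReal.coe_ofNat]; linarith

variable {m : ℕ}

/-- Dropping one coordinate is 1-Lipschitz and its image of the sphere contains a nonempty open set
of `ℝ^m`. The target carries the sup norm, for which Hausdorff measure is Lebesgue measure. -/
lemma hausdorffMeasure_sphere_ne_zero :
    (μH[(m : ℝ)] : Measure (EuclideanSpace ℝ (Fin (m + 1)))) (sphere 0 1) ≠ 0 := by
  let P : EuclideanSpace ℝ (Fin (m + 1)) → (Fin m → ℝ) := fun x i ↦ x i.succ
  have hP : LipschitzWith 1 P := by
    refine LipschitzWith.of_dist_le_mul fun x y ↦ ?_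
    rw [NNReal.coe_one, one_mul, dist_pi_le_iff dist_nonneg]
    intro i
    have := PiLp.norm_apply_le (x - y) i.succ
    rwa [← dist_eq_norm, PiLp.sub_apply, ← dist_eq_norm] at this
  have h1 := hP.hausdorffMeasure_image_le (Nat.cast_nonneg m) (sphere 0 1)
  have hvol : (μH[(m : ℝ)] : Measure (Fin m → ℝ)) = volume := by
    have := hausdorffMeasure_pi_real (ι := Fin m)
    rwa [Fintype.card_fin] at this
  let U : Set (Fin m → ℝ) := {u | ∑ i, u i ^ 2 < 1}
  have hU : IsOpen U := isOpen_lt (by fun_prop) continuous_const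
  have hUP : U ⊆ P '' sphere 0 1 := by
    intro u hu
    refine ⟨WithLp.toLp 2 (Fin.cons (Real.sqrt (1 - ∑ i, u i ^ 2)) u), ?_, ?_⟩
    · rw [mem_sphere_zero_iff_norm, EuclideanSpace.norm_eq, Real.sqrt_eq_one, Fin.sum_univ_succ]
      have : 0 ≤ 1 - ∑ i, u i ^ 2 := by have : ∑ i, u i ^ 2 < 1 := hu; linarith
      simp [Real.sq_sqrt this]
    · rfl
  intro h0
  have hU0 : (volume : Measure (Fin m → ℝ)) U = 0 := by
    rw [← hvol]
    refine measure_mono_null hUP (le_antisymm (h1.trans ?_) bot_le)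
    rw [h0, mul_zero]
  exact (hU.measure_pos volume ⟨0, by simp [U]⟩).ne' hU0

/-- The sphere is covered by the radial projections of the `2(m+1)` faces of the cube
`[-1,1]^(m+1)`. Each face is a Lipschitz image of an `m`-dimensional cube and lies outside the open
unit ball, where radial projection is 2-Lipschitz. -/
lemma hausdorffMeasure_sphere_ne_top :
    (μH[(m : ℝ)] : Measure (EuclideanSpace ℝ (Fin (m + 1)))) (sphere 0 1) ≠ ⊤ := by
  have hvol : (μH[(m : ℝ)] : Measure (Fin m → ℝ)) = volume := by
    have := hausdorffMeasure_pi_real (ι := Fin m)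
    rwa [Fintype.card_fin] at this
  let F : Fin (m + 1) → ℝ → (Fin m → ℝ) → EuclideanSpace ℝ (Fin (m + 1)) :=
    fun i s u ↦ WithLp.toLp 2 (i.insertNth s u)
  let Q : Set (Fin m → ℝ) := Icc (fun _ ↦ -1) (fun _ ↦ 1)
  have hQ : (μH[(m : ℝ)] : Measure (Fin m → ℝ)) Q ≠ ⊤ := by
    rw [hvol]; exact isCompact_Icc.measure_lt_top.ne
  have hF : ∀ i s, ∃ C, LipschitzWith C (F i s) := by
    intro i s
    have h1 : LipschitzWith 1 (fun u : Fin m → ℝ ↦ (i.insertNth s u : Fin (m + 1) → ℝ)) := by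
      refine LipschitzWith.of_dist_le_mul fun x y ↦ ?_
      rw [NNReal.coe_one, one_mul, dist_pi_le_iff dist_nonneg]
      intro j
      refine Fin.succAboveCases i ?_ (fun k ↦ ?_) j
      · simp
      · simp only [Fin.insertNth_apply_succAbove]
        exact dist_le_pi_dist x y k
    exact ⟨_, (PiLp.lipschitzWith_toLp 2 (fun _ : Fin (m + 1) ↦ ℝ)).comp h1⟩
  have hFn : ∀ i, ∀ s ∈ ({1, -1} : Finset ℝ), ∀ u, 1 ≤ ‖F i s u‖ := by
    intro i s hs u
    have h1 := PiLp.norm_apply_le (F i s u) i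
    have h2 : F i s u i = s := by simp [F]
    rw [h2] at h1
    rcases (by simpa using hs : s = 1 ∨ s = -1) with rfl | rfl <;> simpa using h1
  have hcov : sphere (0 : EuclideanSpace ℝ (Fin (m + 1))) 1 ⊆
      ⋃ i : Fin (m + 1), ⋃ s ∈ ({1, -1} : Finset ℝ), (fun x ↦ ‖x‖⁻¹ • x) '' (F i s '' Q) := by
    intro x hx
    rw [mem_sphere_zero_iff_norm] at hx
    obtain ⟨i, hi⟩ := Finite.exists_max (fun i ↦ |x i|)
    have hi0 : 0 < |x i| := by
      by_contra h0
      have : x = 0 := by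
        ext j
        have := (hi j).trans (not_lt.1 h0)
        simpa using this
      rw [this, norm_zero] at hx
      exact zero_ne_one hx
    have hne : x i ≠ 0 := abs_pos.1 hi0
    refine mem_iUnion.2 ⟨i, mem_iUnion₂.2 ⟨x i / |x i|, ?_, ?_⟩⟩
    · rcases lt_or_gt_of_ne hne with h | h
      · simp [abs_of_neg h, div_neg, div_self hne]
      · simp [abs_of_pos h, div_self hne]
    have hFx : F i (x i / |x i|) (fun k ↦ x (i.succAbove k) / |x i|) = |x i|⁻¹ • x := by
      ext j
      refine Fin.succAboveCases i ?_ (fun k ↦ ?_) j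
      · simp [F, div_eq_inv_mul]
      · simp [F, div_eq_inv_mul]
    refine ⟨_, ⟨fun k ↦ x (i.succAbove k) / |x i|, ?_, hFx⟩, ?_⟩
    · rw [mem_Icc, Pi.le_def, Pi.le_def, ← forall_and]
      intro k
      rw [← abs_le, abs_div, abs_abs]
      exact (div_le_one hi0).2 (hi _)
    · simp only [norm_smul, hx, norm_inv, Real.norm_eq_abs, abs_abs, mul_one, inv_inv, smul_smul]
      rw [mul_inv_cancel₀ hi0.ne', one_smul]
  have hfin : ∀ i : Fin (m + 1), ∀ s ∈ ({1, -1} : Finset ℝ),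
      μH[(m : ℝ)] ((fun x ↦ ‖x‖⁻¹ • x) '' (F i s '' Q)) < ⊤ := by
    intro i s hs
    obtain ⟨C, hC⟩ := hF i s
    have hsub : F i s '' Q ⊆ {x | 1 ≤ ‖x‖} := by
      rintro _ ⟨u, -, rfl⟩
      exact hFn i s hs u
    refine ((lipschitzOnWith_normalize.mono hsub).hausdorffMeasure_image_le
      (Nat.cast_nonneg m)).trans_lt (ENNReal.mul_lt_top (by simp) ?_)
    refine (hC.hausdorffMeasure_image_le (Nat.cast_nonneg m) Q).trans_lt
      (ENNReal.mul_lt_top (by simp) hQ.lt_top)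
  refine ((measure_mono hcov).trans_lt ?_).ne
  refine (measure_iUnion_fintype_le _ _).trans_lt (ENNReal.sum_lt_top.2 fun i _ ↦ ?_)
  exact (measure_biUnion_finset_le _ _).trans_lt (ENNReal.sum_lt_top.2 fun s hs ↦ hfin i s hs)

end Sphere

/-! ### Polar coordinates on a shell, up to a constant -/

section Angular

variable {m : ℕ}

/-- The spherical shell `a ≤ ‖x‖ < b`. -/
def shell (E : Type*) [NormedAddCommGroup E] (a b : ℝ) : Set E := {x | ‖x‖ ∈ Ico a b}

lemma measurableSet_shell {E : Type*} [NormedAddCommGroup E] [MeasurableSpace E] [BorelSpace E]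
    (a b : ℝ) : MeasurableSet (shell E a b) := measurable_norm measurableSet_Ico

lemma measurable_normalize {E : Type*} [NormedAddCommGroup E] [NormedSpace ℝ E]
    [MeasurableSpace E] [BorelSpace E] [SecondCountableTopology E] :
    Measurable fun x : E ↦ ‖x‖⁻¹ • x :=
  measurable_norm.inv.smul measurable_id

/-- The weight `‖x‖ ^ (-d)`. -/
noncomputable def radialWeight (d : ℕ) {E : Type*} [NormedAddCommGroup E] (x : E) : ℝ≥0 := (‖x‖₊ ^ d)⁻¹

lemma measurable_radialWeight (d : ℕ) {E : Type*} [NormedAddCommGroup E]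
    [MeasurableSpace E] [BorelSpace E] : Measurable (radialWeight d : E → ℝ≥0) :=
  (measurable_nnnorm.pow_const d).inv

/-- The push-forward to the unit sphere of the measure `‖x‖ ^ (-d) dx` on a shell. -/
noncomputable def angularMeasure (d : ℕ) (a b : ℝ) : Measure (EuclideanSpace ℝ (Fin d)) :=
  (((volume.restrict (shell (EuclideanSpace ℝ (Fin d)) a b)).withDensity
    (fun x ↦ (radialWeight d x : ℝ≥0∞))).map fun x ↦ ‖x‖⁻¹ • x)

lemma angularMeasure_apply {d : ℕ} (a b : ℝ) {s : Set (EuclideanSpace ℝ (Fin d))}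
    (hs : MeasurableSet s) : angularMeasure d a b s =
      ∫⁻ x, ((fun x ↦ ‖x‖⁻¹ • x) ⁻¹' s ∩ shell _ a b).indicator
        (fun x ↦ (radialWeight d x : ℝ≥0∞)) x := by
  rw [angularMeasure, Measure.map_apply measurable_normalize hs,
    withDensity_apply _ (measurable_normalize hs), Measure.restrict_restrict
      (measurable_normalize hs), lintegral_indicator
      ((measurable_normalize hs).inter (measurableSet_shell a b))]

instance isFiniteMeasure_angularMeasure {d : ℕ} {a b : ℝ} [ha : Fact (0 < a)] :
    IsFiniteMeasure (angularMeasure d a b) := by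
  refine ⟨?_⟩
  rw [angularMeasure_apply a b MeasurableSet.univ, preimage_univ, univ_inter,
    lintegral_indicator (measurableSet_shell a b)]
  have hfin : volume (shell (EuclideanSpace ℝ (Fin d)) a b) < ⊤ :=
    (measure_mono fun x hx ↦ by
      rw [mem_ball_zero_iff]; exact hx.2).trans_lt (measure_ball_lt_top (x := 0) (r := b))
  have ha' := ha.out
  refine lt_of_le_of_lt (setLIntegral_mono' (g := fun _ ↦ ((Real.toNNReal a ^ d)⁻¹ : ℝ≥0∞))
    (measurableSet_shell a b) fun x hx ↦ ?_) ?_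
  · have h1 : a.toNNReal ≤ ‖x‖₊ := by
      rw [← NNReal.coe_le_coe, Real.coe_toNNReal _ ha'.le]; exact hx.1
    have h0 : 0 < a.toNNReal := Real.toNNReal_pos.2 ha'
    rw [radialWeight, ENNReal.coe_inv (pow_pos (h0.trans_le h1) d).ne', ENNReal.inv_le_inv]
    exact_mod_cast pow_le_pow_left₀ (by positivity) h1 d
  · rw [setLIntegral_const]
    refine ENNReal.mul_lt_top ?_ hfin
    rw [ENNReal.inv_lt_top]
    have h0 : 0 < a.toNNReal := Real.toNNReal_pos.2 ha'
    exact_mod_cast pow_pos h0 d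

lemma measurePreserving_angularMeasure {d : ℕ} (a b : ℝ)
    (e : EuclideanSpace ℝ (Fin d) ≃ₗᵢ[ℝ] EuclideanSpace ℝ (Fin d)) :
    MeasurePreserving e (angularMeasure d a b) (angularMeasure d a b) := by
  have hem : Measurable e := e.continuous.measurable
  refine ⟨hem, ?_⟩
  ext s hs
  rw [Measure.map_apply hem hs, angularMeasure_apply a b (hem hs), angularMeasure_apply a b hs]
  symm
  rw [← (LinearIsometryEquiv.measurePreserving e).lintegral_comp_emb
      e.toHomeomorph.measurableEmbedding]
  refine lintegral_congr fun x ↦ ?_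
  classical
  rw [indicator_apply, indicator_apply]
  have hiff : (e x ∈ (fun x ↦ ‖x‖⁻¹ • x) ⁻¹' s ∩ shell _ a b) ↔
      x ∈ (fun x ↦ ‖x‖⁻¹ • x) ⁻¹' (e ⁻¹' s) ∩ shell _ a b := by
    simp only [mem_inter_iff, mem_preimage, map_smul, LinearIsometryEquiv.norm_map,
      shell, mem_ofPred_eq]
  simp only [hiff, radialWeight, LinearIsometryEquiv.nnnorm_map]

lemma ae_angularMeasure_mem_sphere {d : ℕ} {a b : ℝ} (ha : 0 < a) :
    ∀ᵐ x ∂angularMeasure d a b, x ∈ sphere (0 : EuclideanSpace ℝ (Fin d)) 1 := by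
  rw [ae_iff]
  rw [show {x : EuclideanSpace ℝ (Fin d) | x ∉ sphere 0 1} = (sphere 0 1)ᶜ from rfl,
    angularMeasure_apply _ _ isClosed_sphere.measurableSet.compl]
  rw [lintegral_eq_zero_of_ae_eq_zero]
  refine Eventually.of_forall fun x ↦ indicator_of_notMem ?_ _
  rintro ⟨h1, h2⟩
  apply h1
  have : ‖x‖ ≠ 0 := (ha.trans_le h2.1).ne'
  simp [norm_smul, this]

/-- Both measures are finite, carried by the sphere and invariant under all linear isometries, hence
uniformly distributed there. The constant is left unspecified, since only the vanishing of integrals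
is transferred. -/
theorem angularMeasure_eq_smul_hausdorff {a b : ℝ} (ha : 0 < a) :
    ∃ c : ℝ≥0∞, angularMeasure (m + 1) a b = c • (μH[(m : ℝ)]).restrict (sphere 0 1) := by
  have : Fact (0 < a) := ⟨ha⟩
  set ν := (μH[(m : ℝ)] : Measure (EuclideanSpace ℝ (Fin (m + 1)))).restrict (sphere 0 1) with hν
  have : IsFiniteMeasure ν := ⟨by
    rw [hν, Measure.restrict_apply_univ]; exact hausdorffMeasure_sphere_ne_top.lt_top⟩
  have hinv : ∀ e : EuclideanSpace ℝ (Fin (m + 1)) ≃ₗᵢ[ℝ] EuclideanSpace ℝ (Fin (m + 1)),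
      MeasurePreserving e ν ν := by
    intro e
    have := (e.toIsometryEquiv.measurePreserving_hausdorffMeasure (m : ℝ)).restrict_preimage
      (s := sphere 0 1) isClosed_sphere.measurableSet
    have h2 : e.toIsometryEquiv ⁻¹' sphere 0 1 = sphere 0 1 := by
      ext x; simp
    rwa [h2] at this
  obtain ⟨x₀, hx₀⟩ : (sphere (0 : EuclideanSpace ℝ (Fin (m + 1))) 1).Nonempty :=
    NormedSpace.sphere_nonempty.2 zero_le_one
  have hnorm : ∀ x ∈ sphere (0 : EuclideanSpace ℝ (Fin (m + 1))) 1, ‖x‖ = ‖x₀‖ := fun x hx ↦ by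
    rw [mem_sphere_zero_iff_norm.1 hx, mem_sphere_zero_iff_norm.1 hx₀]
  refine ⟨_, eq_smul_of_uniformlyDistributed (ν := ν) (S := sphere 0 1)
    (g := fun ρ ↦ angularMeasure (m + 1) a b (ball x₀ ρ)) (h := fun ρ ↦ ν (ball x₀ ρ))
    (ae_angularMeasure_mem_sphere ha) (ae_restrict_mem isClosed_sphere.measurableSet)
    (fun ρ _ x hx ↦ measure_ball_eq_of_invariant (measurePreserving_angularMeasure a b)
      (hnorm x hx) ρ)
    (fun ρ _ x hx ↦ measure_ball_eq_of_invariant hinv (hnorm x hx) ρ) (fun ρ hρ h0 ↦ ?_)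
    ⟨x₀, hx₀⟩⟩
  -- If one ball centred on the sphere were null, all of that radius would be, and finitely many of
  -- them cover the sphere.
  obtain ⟨t, ht, hcov⟩ := (isCompact_sphere (0 : EuclideanSpace ℝ (Fin (m + 1))) 1).elim_nhds_subcover
    (fun x ↦ ball x ρ) (fun x _ ↦ ball_mem_nhds x hρ)
  refine hausdorffMeasure_sphere_ne_zero (m := m) ?_
  have h1 : ν (sphere 0 1) = 0 := measure_mono_null hcov <|
    (measure_biUnion_null_iff t.countable_toSet).2 fun x hx ↦ by
      rw [measure_ball_eq_of_invariant hinv (hnorm x (ht x hx)) ρ]; exact h0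
  rwa [hν, Measure.restrict_apply_self] at h1

/-- If a `(-d)`-homogeneous function has zero integral over the half-sphere, then it has zero
integral over the corresponding half of any spherical shell. -/
theorem setIntegral_half_shell_eq_zero {Ψ : EuclideanSpace ℝ (Fin (m + 1)) → ℝ}
    (hm : Measurable Ψ) (hΨ : ∀ x, x ≠ 0 → Ψ x = (‖x‖ ^ (m + 1))⁻¹ * Ψ (‖x‖⁻¹ • x))
    {a b : ℝ} (ha : 0 < a) (ξ : EuclideanSpace ℝ (Fin (m + 1)))
    (h0 : ∫ ζ in halfSphere ξ, Ψ ζ ∂(μH[(m : ℝ)]) = 0) :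
    ∫ x in {x | 0 < ⟪ξ, x⟫} ∩ shell _ a b, Ψ x = 0 := by
  obtain ⟨c, hc⟩ := angularMeasure_eq_smul_hausdorff (m := m) (b := b) ha
  have hHm : MeasurableSet (halfSphere ξ) := by
    have h1 : MeasurableSet {ζ : EuclideanSpace ℝ (Fin (m + 1)) | 0 < ⟪ζ, ξ⟫} :=
      (isOpen_lt continuous_const (continuous_id.inner continuous_const)).measurableSet
    exact isClosed_sphere.measurableSet.inter h1
  have hHm' : MeasurableSet {x : EuclideanSpace ℝ (Fin (m + 1)) | 0 < ⟪ξ, x⟫} :=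
    (isOpen_lt continuous_const (continuous_const.inner continuous_id)).measurableSet
  -- Unfolded, this is the integral of `‖x‖^(-d) Ψ(x/‖x‖)` over the half shell, and by homogeneity
  -- the integrand is `Ψ x`.
  have h1 : ∫ x, (halfSphere ξ).indicator Ψ x ∂angularMeasure (m + 1) a b = 0 := by
    rw [hc, integral_smul_measure, integral_indicator hHm, Measure.restrict_restrict hHm,
      inter_eq_self_of_subset_left (fun x hx ↦ hx.1), h0, smul_zero]
  rw [angularMeasure, integral_map measurable_normalize.aemeasurable
    (hm.indicator hHm).aestronglyMeasurable, integral_withDensity_eq_integral_smul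
    (measurable_radialWeight _)] at h1
  refine Eq.trans ?_ h1
  rw [inter_comm, ← setIntegral_indicator hHm']
  refine setIntegral_congr_fun (measurableSet_shell a b) fun x hx ↦ ?_
  have hx0 : 0 < ‖x‖ := ha.trans_le hx.1
  have hmem : ‖x‖⁻¹ • x ∈ halfSphere ξ ↔ 0 < ⟪ξ, x⟫ := by
    simp only [halfSphere, mem_sphere_iff_norm, sub_zero, mem_ofPred_eq, norm_smul, norm_inv,
      norm_norm, inv_mul_cancel₀ hx0.ne', true_and, real_inner_smul_left, real_inner_comm x ξ]
    rw [mul_pos_iff_of_pos_left (inv_pos.2 hx0)]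
  by_cases hx' : 0 < ⟪ξ, x⟫
  · simp only [indicator, hmem, mem_ofPred_eq, hx', if_true]
    rw [hΨ x (norm_pos_iff.1 hx0)]
    simp [radialWeight, NNReal.smul_def]
  · simp only [indicator, hmem, mem_ofPred_eq, hx', if_false, smul_zero]

end Angular

/-! ### Volumes of ball differences and of slabs -/

section Volume

variable {m : ℕ}

/-- The volume of the unit ball. -/
noncomputable def unitVol (d : ℕ) : ℝ := volume.real (ball (0 : EuclideanSpace ℝ (Fin d)) 1)

lemma unitVol_nonneg (d : ℕ) : 0 ≤ unitVol d := measureReal_nonneg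

lemma volume_real_ball {d : ℕ} (x : EuclideanSpace ℝ (Fin d)) {r : ℝ} (hr : 0 < r) :
    volume.real (ball x r) = r ^ d * unitVol d := by
  rw [Measure.real, Measure.addHaar_ball_of_pos _ _ hr, ENNReal.toReal_mul,
    ENNReal.toReal_ofReal (by positivity), finrank_euclideanSpace_fin]
  rfl

lemma volume_ball_eq {d : ℕ} (x : EuclideanSpace ℝ (Fin d)) {r : ℝ} (hr : 0 < r) :
    volume (ball x r) = ENNReal.ofReal (r ^ d * unitVol d) := by
  rw [← volume_real_ball x hr, ofReal_measureReal]

/-- The mean value bound on `ρ^(m+1) - s^(m+1)`. Negative `s` is allowed so that `s = ρ - δ` can be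
used without restricting `δ`. -/
lemma volume_ball_diff_ball_le (x : EuclideanSpace ℝ (Fin (m + 1))) {ρ s : ℝ} (hρ : 0 < ρ)
    (hs : s ≤ ρ) : volume (ball x ρ \ ball x s) ≤
      ENNReal.ofReal (unitVol (m + 1) * (m + 1) * ρ ^ m * (ρ - s)) := by
  have hω := unitVol_nonneg (m + 1)
  rcases le_or_gt s 0 with h | h
  · rw [ball_eq_empty.2 h, sdiff_empty, volume_ball_eq x hρ]
    refine ENNReal.ofReal_le_ofReal ?_
    have h1 : ρ * 1 ≤ (ρ - s) * (m + 1) := by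
      gcongr
      · linarith
      · have : (0 : ℝ) ≤ m := Nat.cast_nonneg m
        linarith
    calc ρ ^ (m + 1) * unitVol (m + 1) = unitVol (m + 1) * ρ ^ m * (ρ * 1) := by ring
      _ ≤ unitVol (m + 1) * ρ ^ m * ((ρ - s) * (m + 1)) := by gcongr
      _ = _ := by ring
  · rw [measure_sdiff (ball_subset_ball hs) measurableSet_ball.nullMeasurableSet
      measure_ball_lt_top.ne, volume_ball_eq x hρ, volume_ball_eq x h,
      ← ENNReal.ofReal_sub _ (by positivity)]
    refine ENNReal.ofReal_le_ofReal ?_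
    have h1 := abs_pow_sub_pow_le ρ s (m + 1)
    rw [abs_of_pos hρ, abs_of_pos h, max_eq_left hs, abs_of_nonneg (sub_nonneg.2 hs)] at h1
    have h2 := (le_abs_self _).trans h1
    simp only [Nat.cast_add, Nat.cast_one, Nat.add_sub_cancel] at h2
    calc ρ ^ (m + 1) * unitVol (m + 1) - s ^ (m + 1) * unitVol (m + 1)
        = unitVol (m + 1) * (ρ ^ (m + 1) - s ^ (m + 1)) := by ring
      _ ≤ unitVol (m + 1) * ((ρ - s) * (m + 1) * ρ ^ m) := by gcongr
      _ = _ := by ring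

lemma volume_ball_diff_ball_le' (x y : EuclideanSpace ℝ (Fin (m + 1))) {ρ : ℝ} (hρ : 0 < ρ) :
    volume (ball x ρ \ ball y ρ) ≤
      ENNReal.ofReal (unitVol (m + 1) * (m + 1) * ρ ^ m * dist x y) := by
  have h := volume_ball_diff_ball_le x hρ (s := ρ - dist x y) (by linarith [dist_nonneg (x := x) (y := y)])
  rw [sub_sub_cancel] at h
  refine (measure_mono (sdiff_subset_sdiff_right ?_)).trans h
  exact ball_subset_ball' (by linarith)

lemma volume_box {d : ℕ} (c w : Fin d → ℝ) :
    volume {u : EuclideanSpace ℝ (Fin d) | ∀ i, |u i - c i| ≤ w i} = ∏ i, ENNReal.ofReal (2 * w i) := by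
  have h1 := (PiLp.volume_preserving_ofLp (Fin d)).measure_preimage
    (s := Icc (fun i ↦ c i - w i) (fun i ↦ c i + w i)) measurableSet_Icc.nullMeasurableSet
  rw [Real.volume_Icc_pi] at h1
  have h2 : {u : EuclideanSpace ℝ (Fin d) | ∀ i, |u i - c i| ≤ w i} =
      WithLp.ofLp ⁻¹' Icc (fun i ↦ c i - w i) (fun i ↦ c i + w i) := by
    ext u
    simp only [mem_ofPred_eq, mem_preimage, mem_Icc, Pi.le_def, ← forall_and, abs_le]
    refine forall_congr' fun i ↦ ⟨fun h ↦ ⟨by linarith, by linarith⟩, fun h ↦ ⟨by linarith, by linarith⟩⟩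
  rw [h2, h1]
  refine Finset.prod_congr rfl fun i _ ↦ ?_
  congr 1
  ring

/-- The volume of the intersection of a ball with a slab. -/
lemma volume_slab_le {ν : EuclideanSpace ℝ (Fin (m + 1))} (hν : ‖ν‖ = 1)
    (y : EuclideanSpace ℝ (Fin (m + 1))) {ρ : ℝ} (hρ : 0 ≤ ρ) (s : ℝ) {t : ℝ} (ht : 0 ≤ t) :
    volume {x | x ∈ ball y ρ ∧ |⟪ν, x⟫ - s| ≤ t} ≤ ENNReal.ofReal (2 ^ (m + 1) * ρ ^ m * t) := by
  -- In an orthonormal basis starting with `ν`, the set lies in a box of half-width `t` along `ν`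
  -- and `ρ` along the other axes.
  obtain ⟨b, hb⟩ : ∃ b : OrthonormalBasis (Fin (m + 1)) ℝ (EuclideanSpace ℝ (Fin (m + 1))),
      b 0 = ν := by
    have ho : Orthonormal ℝ (({0} : Set (Fin (m + 1))).domRestrict fun _ ↦ ν) := by
      refine ⟨fun i ↦ hν, fun i j hij ↦ (hij (Subsingleton.elim i j)).elim⟩
    obtain ⟨b, hb⟩ := ho.exists_orthonormalBasis_extension_of_card_eq
      (by rw [finrank_euclideanSpace])
    exact ⟨b, hb 0 rfl⟩
  let c : Fin (m + 1) → ℝ := Fin.cons s fun i ↦ ⟪b i.succ, y⟫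
  let w : Fin (m + 1) → ℝ := Fin.cons t fun _ ↦ ρ
  have hsub : {x | x ∈ ball y ρ ∧ |⟪ν, x⟫ - s| ≤ t} ⊆
      b.repr ⁻¹' {u : EuclideanSpace ℝ (Fin (m + 1)) | ∀ i, |u i - c i| ≤ w i} := by
    rintro x ⟨hx, hxs⟩ i
    rw [b.repr_apply_apply]
    refine Fin.cases ?_ (fun i ↦ ?_) i
    · simpa only [hb, c, w, Fin.cons_zero] using hxs
    · simp only [c, w, Fin.cons_succ]
      rw [← inner_sub_right]
      refine (abs_real_inner_le_norm _ _).trans ?_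
      rw [b.norm_eq_one, one_mul, ← dist_eq_norm]
      exact hx.le
  have hmeas : MeasurableSet {u : EuclideanSpace ℝ (Fin (m + 1)) | ∀ i, |u i - c i| ≤ w i} := by
    rw [ofPred_forall]
    refine MeasurableSet.iInter fun i ↦ (isClosed_le (by fun_prop) continuous_const).measurableSet
  refine (measure_mono hsub).trans ?_
  rw [b.measurePreserving_repr.measure_preimage hmeas.nullMeasurableSet, volume_box,
    Fin.prod_univ_succ]
  simp only [w, Fin.cons_zero, Fin.cons_succ, Finset.prod_const, Finset.card_univ, Fintype.card_fin]
  rw [← ENNReal.ofReal_pow (by positivity), ← ENNReal.ofReal_mul (by positivity)]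
  refine (congrArg _ ?_).le
  ring

end Volume

/-! ### `L¹` modulus of continuity of a truncated kernel -/

section Kernel

variable {m : ℕ} {F : Type*} [NormedAddCommGroup F]

/-- The `L¹`-modulus of continuity of a kernel that is bounded and Lipschitz on a shell and
vanishes off it. -/
theorem lintegral_shell_indicator_sub_le {K : EuclideanSpace ℝ (Fin (m + 1)) → F} {M r : ℝ}
    (hM : 0 ≤ M) (hr : 0 < r) (hb : ∀ u ∈ shell _ (r / 2) r, ‖K u‖ ≤ M)
    (hl : ∀ u ∈ shell _ (r / 2) r, ∀ v ∈ shell _ (r / 2) r, ‖K u - K v‖ ≤ M / r * ‖u - v‖)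
    (y z : EuclideanSpace ℝ (Fin (m + 1))) :
    ∫⁻ x, ‖(shell _ (r / 2) r).indicator K (x - y) - (shell _ (r / 2) r).indicator K (x - z)‖ₑ ≤
      ENNReal.ofReal (unitVol (m + 1) * (4 * m + 5) * M * r ^ m * dist y z) := by
  have hω := unitVol_nonneg (m + 1)
  set δ := dist y z with hδ
  have hδ0 : 0 ≤ δ := dist_nonneg
  set S := shell (EuclideanSpace ℝ (Fin (m + 1))) (r / 2) r with hS
  set k := S.indicator K with hk
  -- The points of the shell within `δ` of its complement: an outer and an inner layer. The `min`
  -- keeps every radius at most `r`, so that the volume bound stays linear in `δ` even for large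
  -- `δ`.
  let T : Set (EuclideanSpace ℝ (Fin (m + 1))) := (ball 0 r \ ball 0 (r - δ)) ∪
    (ball 0 (min r (r / 2 + δ)) \ ball 0 (r / 2))
  have hTm : MeasurableSet T := (measurableSet_ball.diff measurableSet_ball).union
    (measurableSet_ball.diff measurableSet_ball)
  have hT : volume T ≤ ENNReal.ofReal (2 * (unitVol (m + 1) * (m + 1) * r ^ m * δ)) := by
    rw [two_mul, ENNReal.ofReal_add (by positivity) (by positivity)]
    refine (measure_union_le _ _).trans (add_le_add ?_ ?_)
    · have := volume_ball_diff_ball_le (0 : EuclideanSpace ℝ (Fin (m + 1))) hr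
        (s := r - δ) (by linarith)
      rwa [sub_sub_cancel] at this
    · have h1 : 0 < min r (r / 2 + δ) := lt_min hr (by linarith)
      refine (volume_ball_diff_ball_le (0 : EuclideanSpace ℝ (Fin (m + 1))) h1
        (s := r / 2) (le_min (by linarith) (by linarith))).trans (ENNReal.ofReal_le_ofReal ?_)
      have h2 : min r (r / 2 + δ) - r / 2 ≤ δ := by linarith [min_le_right r (r / 2 + δ)]
      have h3 : min r (r / 2 + δ) ≤ r := min_le_left _ _
      have h4 : 0 ≤ min r (r / 2 + δ) - r / 2 := by
        linarith [le_min (by linarith : r / 2 ≤ r) (by linarith : r / 2 ≤ r / 2 + δ)]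
      gcongr
  have hST : ∀ u ∈ S, ∀ v, v ∉ S → ‖u - v‖ ≤ δ → u ∈ T := by
    intro u hu v hv huv
    have h1 := abs_norm_sub_norm_le u v
    have h2 := abs_le.1 (h1.trans huv)
    have hu1 : r / 2 ≤ ‖u‖ := hu.1
    have hu2 : ‖u‖ < r := hu.2
    by_cases hvr : r ≤ ‖v‖
    · left
      simp only [Set.mem_sdiff, mem_ball_zero_iff, not_lt]
      exact ⟨hu2, by linarith⟩
    · right
      have : ‖v‖ < r / 2 := by
        by_contra h
        exact hv ⟨not_lt.1 h, not_le.1 hvr⟩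
      simp only [Set.mem_sdiff, mem_ball_zero_iff, not_lt]
      exact ⟨lt_min hu2 (by linarith), hu1⟩
  have hδe : ∀ x, ‖(x - y) - (x - z)‖ = δ := fun x ↦ by
    rw [sub_sub_sub_cancel_left, hδ, dist_eq_norm, norm_sub_rev]
  have hkS : ∀ u ∈ S, k u = K u := fun u hu ↦ indicator_of_mem hu _
  have hkS' : ∀ u, u ∉ S → k u = 0 := fun u hu ↦ indicator_of_notMem hu _
  have hpt : ∀ x, ‖k (x - y) - k (x - z)‖ₑ ≤
      (ball z r).indicator (fun _ ↦ ENNReal.ofReal (M / r * δ)) x +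
      (T.indicator (fun _ ↦ ENNReal.ofReal M) (x - y) +
        T.indicator (fun _ ↦ ENNReal.ofReal M) (x - z)) := by
    intro x
    by_cases h1 : x - y ∈ S <;> by_cases h2 : x - z ∈ S
    · rw [hkS _ h1, hkS _ h2, ← ofReal_norm]
      have hxz : x ∈ ball z r := by
        rw [mem_ball, dist_eq_norm]; exact h2.2
      refine le_add_right ?_
      rw [indicator_of_mem hxz]
      refine ENNReal.ofReal_le_ofReal ((hl _ h1 _ h2).trans_eq ?_)
      rw [hδe]
    · rw [hkS _ h1, hkS' _ h2, sub_zero, ← ofReal_norm]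
      refine le_add_left (le_add_right ?_)
      rw [indicator_of_mem (hST _ h1 _ h2 (hδe x).le)]
      exact ENNReal.ofReal_le_ofReal (hb _ h1)
    · rw [hkS' _ h1, hkS _ h2, zero_sub, enorm_neg, ← ofReal_norm]
      refine le_add_left (le_add_left ?_)
      rw [indicator_of_mem (hST _ h2 _ h1 (by rw [norm_sub_rev]; exact (hδe x).le))]
      exact ENNReal.ofReal_le_ofReal (hb _ h2)
    · rw [hkS' _ h1, hkS' _ h2, sub_zero, enorm_zero]
      exact bot_le
  refine (lintegral_mono hpt).trans ?_
  have hTi : Measurable (T.indicator (fun _ ↦ ENNReal.ofReal M)) := measurable_const.indicator hTm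
  rw [lintegral_add_left (measurable_const.indicator measurableSet_ball),
    lintegral_add_left (f := fun x ↦ T.indicator (fun _ ↦ ENNReal.ofReal M) (x - y))
      (hTi.comp (measurable_id.sub_const y)),
    lintegral_sub_right_eq_self (fun x ↦ T.indicator (fun _ ↦ ENNReal.ofReal M) x),
    lintegral_sub_right_eq_self (fun x ↦ T.indicator (fun _ ↦ ENNReal.ofReal M) x),
    lintegral_indicator_const measurableSet_ball, lintegral_indicator_const hTm,
    volume_ball_eq z hr]
  refine (add_le_add le_rfl (add_le_add (mul_le_mul_right hT _) (mul_le_mul_right hT _))).trans ?_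
  rw [← ENNReal.ofReal_mul (by positivity), ← ENNReal.ofReal_mul (by positivity),
    ← ENNReal.ofReal_add (by positivity) (by positivity),
    ← ENNReal.ofReal_add (by positivity) (by positivity)]
  refine ENNReal.ofReal_le_ofReal (le_of_eq ?_)
  field_simp
  ring

end Kernel

/-! ### Dyadic sums and non-concentration of a measure at a point -/

section Dyadic

lemma ennreal_rpow_neg_le_rpow_neg {s : ℝ} (hs : 0 ≤ s) {a b : ℝ≥0∞} (h : a ≤ b) :
    b ^ (-s) ≤ a ^ (-s) := by
  rw [ENNReal.rpow_neg, ENNReal.rpow_neg, ENNReal.inv_le_inv]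
  exact ENNReal.rpow_le_rpow h hs

/-- A geometric sum over all dyadic scales below a given one. -/
theorem exists_tsum_dyadic_le {γ : ℝ} (hγ : 0 < γ) : ∃ C : ℝ≥0∞, C ≠ ⊤ ∧ ∀ c : ℝ, 0 < c →
    ∑' n : ℤ, (if (2 : ℝ) ^ n ≤ c then ENNReal.ofReal (((2 : ℝ) ^ n / c) ^ γ) else 0) ≤ C := by
  have hr : ENNReal.ofReal ((2 : ℝ) ^ (-γ)) < 1 := by
    rw [ENNReal.ofReal_lt_one]
    exact Real.rpow_lt_one_of_one_lt_of_neg one_lt_two (by linarith)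
  refine ⟨(1 - ENNReal.ofReal ((2 : ℝ) ^ (-γ)))⁻¹, ENNReal.inv_ne_top.2 (tsub_pos_of_lt hr).ne',
    fun c hc ↦ ?_⟩
  obtain ⟨N, hN1, hN2⟩ := exists_mem_Ico_zpow hc (one_lt_two (α := ℝ))
  have hinj : Function.Injective fun j : ℕ ↦ N - (j : ℤ) := fun i j hij ↦ by
    simpa using hij
  rw [← hinj.tsum_eq, ← ENNReal.tsum_geometric]
  · refine ENNReal.tsum_le_tsum fun j ↦ ?_
    split_ifs with h
    · rw [← ENNReal.ofReal_pow (by positivity)]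
      refine ENNReal.ofReal_le_ofReal ?_
      have h1 : (2 : ℝ) ^ (N - (j : ℤ)) / c ≤ (2 : ℝ) ^ (-(j : ℝ)) := by
        rw [div_le_iff₀ hc, zpow_sub₀ two_ne_zero, zpow_natCast, Real.rpow_neg zero_le_two,
          Real.rpow_natCast, div_eq_mul_inv, mul_comm]
        gcongr
      refine (Real.rpow_le_rpow (by positivity) h1 hγ.le).trans_eq ?_
      rw [← Real.rpow_natCast, ← Real.rpow_mul zero_le_two, ← Real.rpow_mul zero_le_two]
      congr 1
      ring
    · exact bot_le
  · intro n hn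
    rw [Function.mem_support] at hn
    have h1 : (2 : ℝ) ^ n ≤ c := by
      by_contra h
      simp [h] at hn
    have h2 : n < N + 1 := (zpow_lt_zpow_iff_right₀ one_lt_two).1 (h1.trans_lt hN2)
    exact ⟨(N - n).toNat, by simp only; omega⟩

/-- The set contains, with each `y`, every point at least as close to `x`. Either one ball of mass
at most `t` contains it, or it is covered by a directed family of such balls with rational radii,
and the mass passes to the supremum. -/
lemma measure_setOf_measure_closedBall_le {X : Type*} [MetricSpace X] [MeasurableSpace X]
    [BorelSpace X] (μ : Measure X) (x : X) (t : ℝ≥0∞) :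
    μ {y | μ (closedBall x (dist y x)) ≤ t} ≤ t := by
  set S := {y | μ (closedBall x (dist y x)) ≤ t} with hS
  by_cases h : ∃ ρ, μ (closedBall x ρ) ≤ t ∧ S ⊆ closedBall x ρ
  · obtain ⟨ρ, h1, h2⟩ := h
    exact (measure_mono h2).trans h1
  · push Not at h
    have hcov : S ⊆ ⋃ q : {q : ℚ // μ (closedBall x (q : ℝ)) ≤ t}, closedBall x (q.1 : ℝ) := by
      intro y hy
      obtain ⟨z, hz, hzy⟩ := not_subset.1 (h (dist y x) hy)
      rw [mem_closedBall, not_le] at hzy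
      obtain ⟨q, hq1, hq2⟩ := exists_rat_btwn hzy
      refine mem_iUnion.2 ⟨⟨q, (measure_mono (closedBall_subset_closedBall hq2.le)).trans hz⟩, ?_⟩
      exact hq1.le
    refine (measure_mono hcov).trans ?_
    rw [Directed.measure_iUnion]
    · exact iSup_le fun q ↦ q.2
    · intro a b
      rcases le_total a.1 b.1 with hab | hab
      · exact ⟨b, closedBall_subset_closedBall (by exact_mod_cast hab), Subset.rfl⟩
      · exact ⟨a, Subset.rfl, closedBall_subset_closedBall (by exact_mod_cast hab)⟩

/-- A negative power of a function whose sublevel sets have measure at most the level is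
integrable. -/
theorem exists_lintegral_rpow_neg_le {s : ℝ} (hs : 0 ≤ s) (hs1 : s < 1) :
    ∃ C : ℝ≥0∞, C ≠ ⊤ ∧ ∀ {X : Type} [MeasurableSpace X] (μ : Measure X) (G : X → ℝ≥0∞),
      Measurable G → (∀ x, G x ≤ 1) → (∀ t, μ {x | G x ≤ t} ≤ t) →
      ∫⁻ x, G x ^ (-s) ∂μ ≤ C := by
  have hr : (2⁻¹ : ℝ≥0∞) ^ (1 - s) < 1 :=
    ENNReal.rpow_lt_one (by simp) (by linarith)
  refine ⟨(2⁻¹ : ℝ≥0∞) ^ (-s) * (1 - (2⁻¹ : ℝ≥0∞) ^ (1 - s))⁻¹, ENNReal.mul_ne_top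
    (by simp) (ENNReal.inv_ne_top.2 (tsub_pos_of_lt hr).ne'), fun {X} _ μ G hG hG1 hGt ↦ ?_⟩
  -- Layer by layer: `G` is nonzero almost everywhere (level `t = 0`), so `2^(-j-1) ≤ G x ≤ 2^(-j)`
  -- for some `j`. As `{G ≤ 2^(-j)}` has mass at most `2^(-j)`, the resulting series has ratio
  -- `2^(-(1-s)) < 1`.
  have hpt : ∀ᵐ x ∂μ, G x ^ (-s) ≤ ∑' j : ℕ, {x | G x ≤ 2⁻¹ ^ j}.indicator
      (fun _ ↦ ((2⁻¹ : ℝ≥0∞) ^ (j + 1)) ^ (-s)) x := by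
    have h0 : ∀ᵐ x ∂μ, ¬ G x ≤ 0 := by
      rw [ae_iff]; simpa using hGt 0
    filter_upwards [h0] with x hx
    have hx0 : G x ≠ 0 := fun h ↦ hx h.le
    have hxt : G x ≠ ⊤ := ((hG1 x).trans_lt ENNReal.one_lt_top).ne
    obtain ⟨j, hj1, hj2⟩ := exists_nat_pow_near_of_lt_one (ENNReal.toReal_pos hx0 hxt)
      (ENNReal.toReal_le_of_le_ofReal zero_le_one (by simpa using hG1 x))
      (by norm_num : (0 : ℝ) < 2⁻¹) (by norm_num)
    have e : ∀ k : ℕ, (2⁻¹ : ℝ≥0∞) ^ k = ENNReal.ofReal (2⁻¹ ^ k) := fun k ↦ by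
      rw [ENNReal.ofReal_pow (by norm_num), ENNReal.ofReal_inv_of_pos two_pos]; simp
    have h1 : (2⁻¹ : ℝ≥0∞) ^ (j + 1) ≤ G x := by
      rw [e]; exact ENNReal.ofReal_le_of_le_toReal hj1.le
    have h2 : G x ≤ 2⁻¹ ^ j := by
      rw [e]; exact (ENNReal.le_ofReal_iff_toReal_le hxt (by positivity)).2 hj2
    refine le_trans ?_ (ENNReal.le_tsum j)
    rw [indicator_of_mem (by exact h2)]
    exact ennreal_rpow_neg_le_rpow_neg hs h1
  refine (lintegral_mono_ae hpt).trans ?_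
  rw [lintegral_tsum fun j ↦ (measurable_const.indicator
    (measurableSet_le hG measurable_const)).aemeasurable, ← ENNReal.tsum_geometric,
    ← ENNReal.tsum_mul_left]
  refine ENNReal.tsum_le_tsum fun j ↦ ?_
  refine (lintegral_indicator_const_le _ _).trans ((mul_le_mul_right (hGt _) _).trans_eq ?_)
  rw [pow_succ, ENNReal.mul_rpow_of_ne_top (by simp) (by simp)]
  rw [mul_comm (_ ^ (-s)) (_ ^ (-s)), mul_assoc]
  congr 1
  rw [← ENNReal.rpow_natCast, ← ENNReal.rpow_natCast, ← ENNReal.rpow_mul, ← ENNReal.rpow_mul,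
    ← ENNReal.rpow_add _ _ (by simp) (by simp)]
  congr 1
  ring

/-- The sum over all dyadic scales of the local non-concentration of a measure at a point. -/
theorem exists_tsum_nonconcentration_le {s : ℝ} (hs : 0 ≤ s) (hs1 : s < 1) :
    ∃ C : ℝ≥0∞, C ≠ ⊤ ∧ ∀ {X : Type} [MetricSpace X] [MeasurableSpace X] [BorelSpace X]
      (μ : Measure X) (x : X), μ univ ≤ 1 →
      ∑' n : ℤ, μ (ball x (4 * 2 ^ (-n))) ^ (-s) *
        ∫⁻ y in ball x (4 * 2 ^ (-n)), ENNReal.ofReal (dist y x / 2 ^ (-n)) ∂μ ≤ C := by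
  obtain ⟨C₁, hC₁, h₁⟩ := exists_tsum_dyadic_le (one_pos)
  obtain ⟨C₂, hC₂, h₂⟩ := exists_lintegral_rpow_neg_le hs hs1
  refine ⟨C₂ * (4 * C₁), ENNReal.mul_ne_top hC₂ (ENNReal.mul_ne_top (by simp) hC₁),
    fun {X} _ _ _ μ x hμ ↦ ?_⟩
  have : IsFiniteMeasure μ := ⟨hμ.trans_lt ENNReal.one_lt_top⟩
  set G : X → ℝ≥0∞ := fun y ↦ μ (closedBall x (dist y x)) with hG
  have hGm : Measurable G := by
    have : Monotone fun ρ : ℝ ↦ μ (closedBall x ρ) := fun a b hab ↦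
      measure_mono (closedBall_subset_closedBall hab)
    exact this.measurable.comp (continuous_id.dist continuous_const).measurable
  -- For `y` in the ball, the ball contains `closedBall x (dist y x)`; this replaces its negative
  -- power by `G y ^ (-s)`, which no longer depends on `n`.
  have hterm : ∀ n : ℤ, μ (ball x (4 * 2 ^ (-n))) ^ (-s) *
      ∫⁻ y in ball x (4 * 2 ^ (-n)), ENNReal.ofReal (dist y x / 2 ^ (-n)) ∂μ ≤
      ∫⁻ y, G y ^ (-s) * (ball x (4 * 2 ^ (-n))).indicator
        (fun y ↦ ENNReal.ofReal (dist y x / 2 ^ (-n))) y ∂μ := by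
    intro n
    rw [← lintegral_indicator measurableSet_ball]
    refine (lintegral_const_mul_le _ _).trans (lintegral_mono fun y ↦ ?_)
    by_cases hy : y ∈ ball x (4 * 2 ^ (-n))
    · gcongr ?_ * _
      refine ennreal_rpow_neg_le_rpow_neg hs (measure_mono ?_)
      exact closedBall_subset_ball hy
    · simp only [indicator_of_notMem hy, mul_zero, le_refl]
  refine (ENNReal.tsum_le_tsum hterm).trans ?_
  have hdm : ∀ n : ℤ, Measurable ((ball x (4 * (2 : ℝ) ^ (-n))).indicator
      (fun y ↦ ENNReal.ofReal (dist y x / 2 ^ (-n)))) := fun n ↦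
    (((continuous_id.dist continuous_const).div_const _).measurable.ennreal_ofReal).indicator
      measurableSet_ball
  rw [← lintegral_tsum (f := fun (n : ℤ) y ↦ G y ^ (-s) * (ball x (4 * (2 : ℝ) ^ (-n))).indicator
    (fun y ↦ ENNReal.ofReal (dist y x / 2 ^ (-n))) y)
    fun n ↦ ((hGm.pow_const _).mul (hdm n)).aemeasurable]
  have hsum : ∀ y, ∑' n : ℤ, G y ^ (-s) * (ball x (4 * (2 : ℝ) ^ (-n))).indicator
      (fun y ↦ ENNReal.ofReal (dist y x / 2 ^ (-n))) y ≤ G y ^ (-s) * (4 * C₁) := by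
    intro y
    rw [ENNReal.tsum_mul_left]
    gcongr
    rcases (dist_nonneg (x := y) (y := x)).eq_or_lt with h0 | h0
    · refine le_of_eq_of_le (ENNReal.tsum_eq_zero.2 fun n ↦ ?_) bot_le
      simp [indicator, ← h0]
    · refine le_trans ?_ (mul_le_mul_right (h₁ (4 / dist y x) (by positivity)) 4)
      rw [← ENNReal.tsum_mul_left]
      refine ENNReal.tsum_le_tsum fun n ↦ ?_
      by_cases hy : y ∈ ball x (4 * 2 ^ (-n))
      · have h2 : (0 : ℝ) < 2 ^ n := by positivity
        have hle : (2 : ℝ) ^ n ≤ 4 / dist y x := by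
          rw [mem_ball, zpow_neg, ← div_eq_mul_inv, lt_div_iff₀ h2] at hy
          rw [le_div_iff₀ h0]; linarith
        rw [indicator_of_mem hy, if_pos hle, Real.rpow_one, zpow_neg]
        rw [show (4 : ℝ≥0∞) = ENNReal.ofReal 4 by simp, ← ENNReal.ofReal_mul (by norm_num)]
        refine ENNReal.ofReal_le_ofReal (le_of_eq ?_)
        field_simp
      · rw [indicator_of_notMem hy]; exact bot_le
  refine (lintegral_mono hsum).trans ?_
  rw [lintegral_mul_const _ (hGm.pow_const _)]
  gcongr
  exact h₂ μ G hGm (fun y ↦ (measure_mono (subset_univ _)).trans hμ)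
    (measure_setOf_measure_closedBall_le μ x)

end Dyadic

/-! ### Potentials of signed measures and the pointwise comparison -/

section SingleScale

variable {m l : ℕ}

/-- The convolution of the kernel `k` with the signed measure `s μ`. -/
noncomputable def potential {m l : ℕ} (μ : Measure (EuclideanSpace ℝ (Fin (m + 1))))
    (s : EuclideanSpace ℝ (Fin (m + 1)) → ℝ)
    (k : EuclideanSpace ℝ (Fin (m + 1)) → EuclideanSpace ℝ (Fin l))
    (x : EuclideanSpace ℝ (Fin (m + 1))) : EuclideanSpace ℝ (Fin l) :=
  ∫ y, s y • k (x - y) ∂μ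

variable {μ : Measure (EuclideanSpace ℝ (Fin (m + 1)))} [IsFiniteMeasure μ]
  {s : EuclideanSpace ℝ (Fin (m + 1)) → ℝ}
  {k : EuclideanSpace ℝ (Fin (m + 1)) → EuclideanSpace ℝ (Fin l)}
  {M r p L : ℝ}

lemma measurable_potential (hs : Measurable s) (hk : Measurable k) :
    Measurable (potential μ s k) := by
  refine (StronglyMeasurable.integral_prod_right (ν := μ) (f := fun x y ↦ s y • k (x - y)) ?_).measurable
  exact ((hs.comp measurable_snd).smul (hk.comp (measurable_fst.sub measurable_snd))).stronglyMeasurable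

/-- The radius `ρ` is free because the energy is later divided by masses of balls of radius `2r`; in
particular the potential vanishes where that mass does. -/
lemma norm_potential_le (hs1 : ∀ y, |s y| ≤ 1) (hkM : ∀ u, ‖k u‖ ≤ M)
    (hkr : ∀ u, r ≤ ‖u‖ → k u = 0) {ρ : ℝ} (hρ : r ≤ ρ) (x : EuclideanSpace ℝ (Fin (m + 1))) :
    ‖potential μ s k x‖ ≤ M * μ.real (ball x ρ) := by
  have h1 : ∀ y, ‖s y • k (x - y)‖ ≤ (ball x ρ).indicator (fun _ ↦ M) y := by
    intro y
    by_cases hy : y ∈ ball x ρ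
    · rw [indicator_of_mem hy, norm_smul, Real.norm_eq_abs]
      calc |s y| * ‖k (x - y)‖ ≤ 1 * M := by gcongr; exacts [hs1 y, hkM _]
        _ = M := one_mul M
    · rw [indicator_of_notMem hy, hkr, smul_zero, norm_zero]
      rw [mem_ball, dist_comm, dist_eq_norm, not_lt] at hy
      exact hρ.trans hy
  refine (norm_integral_le_of_norm_le ((integrable_const M).indicator measurableSet_ball)
    (Eventually.of_forall h1)).trans_eq ?_
  rw [integral_indicator_const _ measurableSet_ball, smul_eq_mul, mul_comm]

lemma integrable_smul_kernel (hs : Measurable s) (hs1 : ∀ y, |s y| ≤ 1) (hk : Measurable k)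
    (hkM : ∀ u, ‖k u‖ ≤ M) (x : EuclideanSpace ℝ (Fin (m + 1))) :
    Integrable (fun y ↦ s y • k (x - y)) μ := by
  refine Integrable.of_bound (C := M) ((hs.smul (hk.comp (measurable_const.sub measurable_id)))
    |>.aestronglyMeasurable) (Eventually.of_forall fun y ↦ ?_)
  rw [norm_smul, Real.norm_eq_abs]
  calc |s y| * ‖k (x - y)‖ ≤ 1 * M := by gcongr; exacts [hs1 y, hkM _]
    _ = M := one_mul M

/-- Comparison of the potential with that of a point mass. -/
lemma enorm_potential_sub_le (hs : Measurable s) (hs1 : ∀ y, |s y| ≤ 1) (hk : Measurable k)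
    (hkM : ∀ u, ‖k u‖ ≤ M) (hkr : ∀ u, r ≤ ‖u‖ → k u = 0) {x z : EuclideanSpace ℝ (Fin (m + 1))}
    {ρ : ℝ} (hρ : dist x z + r ≤ ρ) :
    ‖potential μ s k x - (∫ y in ball z ρ, s y ∂μ) • k (x - z)‖ₑ ≤
      ∫⁻ y in ball z ρ, ‖k (x - y) - k (x - z)‖ₑ ∂μ := by
  have h1 : potential μ s k x = ∫ y in ball z ρ, s y • k (x - y) ∂μ := by
    rw [potential, setIntegral_eq_integral_of_forall_compl_eq_zero]
    intro y hy
    rw [hkr, smul_zero]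
    rw [mem_ball, not_lt] at hy
    have := dist_triangle y x z
    rw [dist_comm y x, dist_eq_norm x y] at this
    linarith
  have hsi : Integrable s μ := Integrable.of_bound (C := 1) hs.aestronglyMeasurable
    (Eventually.of_forall hs1)
  rw [h1, ← integral_smul_const, ← integral_sub (integrable_smul_kernel hs hs1 hk hkM x).integrableOn
    (hsi.smul_const _).integrableOn]
  refine (enorm_integral_le_lintegral_enorm _).trans (lintegral_mono fun y ↦ ?_)
  rw [← smul_sub, enorm_smul]
  calc ‖s y‖ₑ * ‖k (x - y) - k (x - z)‖ₑ ≤ 1 * ‖k (x - y) - k (x - z)‖ₑ := by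
        gcongr
        rw [← ofReal_norm]
        exact ENNReal.ofReal_le_one.2 (hs1 y)
    _ = _ := one_mul _

/-- Growth and local Lipschitz bound for a positively homogeneous function of degree `p`. -/
structure HomLipschitz (L p : ℝ) (Φ : EuclideanSpace ℝ (Fin l) → ℝ) : Prop where
  measurable : Measurable Φ
  zero : Φ 0 = 0
  smul : ∀ t : ℝ, 0 < t → ∀ a, Φ (t • a) = t ^ p * Φ a
  sub_le : ∀ a b, |Φ a - Φ b| ≤ L * ‖a - b‖ * (max ‖a‖ ‖b‖) ^ (p - 1)

variable {Φ : EuclideanSpace ℝ (Fin l) → ℝ}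

lemma HomLipschitz.abs_le (hΦ : HomLipschitz L p Φ) (hp : 1 < p) (a : EuclideanSpace ℝ (Fin l)) :
    |Φ a| ≤ L * ‖a‖ ^ p := by
  have h := hΦ.sub_le a 0
  rw [hΦ.zero, sub_zero, sub_zero, norm_zero, max_eq_left (norm_nonneg a)] at h
  rcases (norm_nonneg a).eq_or_lt with h0 | h0
  · rw [← h0] at h ⊢
    rw [Real.zero_rpow (by linarith)]
    simpa using h
  · rwa [mul_assoc, ← Real.rpow_one_add' h0.le (by linarith), add_sub_cancel] at h

/-- The pointwise comparison behind the single scale estimate. -/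
lemma abs_div_sub_div_le (hΦ : HomLipschitz L p Φ) (hp : 1 < p) (hL : 0 ≤ L) (hM : 0 ≤ M)
    {g w : EuclideanSpace ℝ (Fin l)} {V N : ℝ} (hV : 0 ≤ V) (hVN : V ≤ N) (hN : 0 < N)
    (hg : ‖g‖ ≤ M * V) (hw : ‖w‖ ≤ M * N) :
    |Φ g / V - Φ w / N| ≤ L * M ^ (p - 1) * N ^ (p - 2) * (M * (N - V) + ‖g - w‖) := by
  have hp1 : 0 < p - 1 := by linarith
  have e1 : N ^ (p - 1) / N = N ^ (p - 2) := by
    rw [div_eq_mul_inv, ← Real.rpow_neg_one, ← Real.rpow_add hN]; congr 1; ring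
  -- The bound `|Φ g| ≤ L (M V)^p ≤ L M^p N^(p-1) V` absorbs the small denominator `V`. If `V = 0`
  -- then `g = 0` and the quotient is zero by convention.
  have h1 : |Φ g / V - Φ g / N| ≤ L * M ^ (p - 1) * N ^ (p - 2) * (M * (N - V)) := by
    rcases hV.eq_or_lt with h0 | h0
    · have : g = 0 := by rw [← h0, mul_zero] at hg; exact norm_le_zero_iff.1 hg
      rw [this, hΦ.zero, zero_div, zero_div, sub_zero, abs_zero]
      have : 0 ≤ N - V := by linarith
      positivity
    · have h2 : Φ g / V - Φ g / N = Φ g * ((N - V) / (V * N)) := by field_simp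
      have h3 : 0 ≤ (N - V) / (V * N) := div_nonneg (by linarith) (by positivity)
      rw [h2, abs_mul, abs_of_nonneg h3]
      have h4 : |Φ g| ≤ L * (M ^ (p - 1) * M * (N ^ (p - 1) * V)) := by
        refine (hΦ.abs_le hp g).trans ?_
        gcongr
        calc ‖g‖ ^ p ≤ (M * V) ^ p := by gcongr
          _ = (M * V) ^ (p - 1) * (M * V) := by
            rw [← Real.rpow_add_one' (by positivity) (by linarith), sub_add_cancel]
          _ = M ^ (p - 1) * M * (V ^ (p - 1) * V) := by
            rw [Real.mul_rpow hM hV]; ring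
          _ ≤ _ := by gcongr
      calc |Φ g| * ((N - V) / (V * N)) ≤
          L * (M ^ (p - 1) * M * (N ^ (p - 1) * V)) * ((N - V) / (V * N)) := by gcongr
        _ = L * M ^ (p - 1) * (N ^ (p - 1) / N) * (M * (N - V)) := by field_simp
        _ = _ := by rw [e1]
  have h2 : |Φ g / N - Φ w / N| ≤ L * M ^ (p - 1) * N ^ (p - 2) * ‖g - w‖ := by
    rw [← sub_div, abs_div, abs_of_pos hN, div_le_iff₀ hN]
    refine (hΦ.sub_le g w).trans ?_
    have h3 : max ‖g‖ ‖w‖ ≤ M * N := max_le (hg.trans (by gcongr)) hw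
    calc L * ‖g - w‖ * max ‖g‖ ‖w‖ ^ (p - 1) ≤ L * ‖g - w‖ * (M * N) ^ (p - 1) := by gcongr
      _ = L * ‖g - w‖ * (M ^ (p - 1) * (N ^ (p - 1) / N * N)) := by
        rw [Real.mul_rpow hM hN.le, div_mul_cancel₀ _ hN.ne']
      _ = _ := by rw [e1]; ring
  calc |Φ g / V - Φ w / N| ≤ |Φ g / V - Φ g / N| + |Φ g / N - Φ w / N| := abs_sub_le _ _ _
    _ ≤ _ := (add_le_add h1 h2).trans_eq (by ring)

end SingleScale

/-! ### Replacing the measure near a point by a point mass -/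

section SingleScale

variable {m l : ℕ} {μ : Measure (EuclideanSpace ℝ (Fin (m + 1)))} [IsFiniteMeasure μ]
  {s : EuclideanSpace ℝ (Fin (m + 1)) → ℝ}
  {k : EuclideanSpace ℝ (Fin (m + 1)) → EuclideanSpace ℝ (Fin l)}
  {M r p L B : ℝ} {Φ : EuclideanSpace ℝ (Fin l) → ℝ}

lemma measurable_measureReal_ball (μ : Measure (EuclideanSpace ℝ (Fin (m + 1))))
    [IsFiniteMeasure μ] (ρ : ℝ) : Measurable fun x ↦ μ.real (ball x ρ) :=
  (measurable_measure_prodMk_left (measurableSet_dist_lt ρ)).ennreal_toReal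

/-- The error made by replacing the measure near `z` by a point mass at `z`. -/
theorem lintegral_enorm_sub_pointMass_le (hΦ : HomLipschitz L p Φ) (hp : 1 < p) (hL : 0 ≤ L)
    (hM : 0 ≤ M) (hr : 0 < r) (hB : 0 ≤ B) (hs : Measurable s) (hs1 : ∀ y, |s y| ≤ 1)
    (hk : Measurable k) (hkM : ∀ u, ‖k u‖ ≤ M) (hkr : ∀ u, r ≤ ‖u‖ → k u = 0)
    (hmod : ∀ y z, ∫⁻ x, ‖k (x - y) - k (x - z)‖ₑ ≤ ENNReal.ofReal (B * M * r ^ m * dist y z))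
    (z : EuclideanSpace ℝ (Fin (m + 1))) (hN : 0 < μ.real (ball z (4 * r))) :
    ∫⁻ x in ball z (2 * r), ‖Φ (potential μ s k x) / μ.real (ball x (2 * r)) -
      Φ ((∫ y in ball z (4 * r), s y ∂μ) • k (x - z)) / μ.real (ball z (4 * r))‖ₑ ≤
    ENNReal.ofReal (L * (2 ^ m * unitVol (m + 1) * (m + 1) + B) * (M ^ p * r ^ (m + 1)) *
      μ.real (ball z (4 * r)) ^ (p - 2)) *
      ∫⁻ y in ball z (4 * r), ENNReal.ofReal (dist y z / r) ∂μ := by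
  have hω := unitVol_nonneg (m + 1)
  set N := μ.real (ball z (4 * r)) with hNdef
  set c := L * M ^ (p - 1) * N ^ (p - 2) with hc
  have hc0 : 0 ≤ c := by positivity
  set σ := ∫ y in ball z (4 * r), s y ∂μ with hσ
  have hσN : |σ| ≤ N := by
    have h1 := norm_setIntegral_le_of_norm_le_const (μ := μ) (s := ball z (4 * r)) (f := s) (C := 1)
      (measure_lt_top _ _) (fun y _ ↦ hs1 y)
    rwa [one_mul] at h1
  -- The radius `4r` is chosen so that, for `x` within `2r` of `z`, it covers both `ball x (2r)` and
  -- all sources seen by the kernel at `x`. The difference `N - V` is the mass of `ball z (4r)`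
  -- outside `ball x (2r)`.
  have hpt : ∀ x ∈ ball z (2 * r), ‖Φ (potential μ s k x) / μ.real (ball x (2 * r)) -
      Φ (σ • k (x - z)) / N‖ₑ ≤ ENNReal.ofReal c * (ENNReal.ofReal M *
        μ (ball z (4 * r) \ ball x (2 * r)) +
        ∫⁻ y in ball z (4 * r), ‖k (x - y) - k (x - z)‖ₑ ∂μ) := by
    intro x hx
    have hsub : ball x (2 * r) ⊆ ball z (4 * r) := ball_subset_ball' (by
      rw [mem_ball] at hx; linarith)
    have hVN : μ.real (ball x (2 * r)) ≤ N := measureReal_mono hsub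
    have h1 := abs_div_sub_div_le (w := σ • k (x - z)) hΦ hp hL hM
      (measureReal_nonneg (μ := μ) (s := ball x (2 * r)))
      hVN hN (norm_potential_le hs1 hkM hkr (by linarith) x) (by
        rw [norm_smul, mul_comm, Real.norm_eq_abs]
        gcongr
        exact hkM _)
    rw [← ofReal_norm, Real.norm_eq_abs]
    refine (ENNReal.ofReal_le_ofReal h1).trans ?_
    rw [ENNReal.ofReal_mul hc0, ENNReal.ofReal_add (mul_nonneg hM (by linarith)) (norm_nonneg _),
      ENNReal.ofReal_mul hM]
    gcongr
    · rw [hNdef, ← measureReal_sdiff hsub measurableSet_ball, ofReal_measureReal]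
    · rw [ofReal_norm]
      exact enorm_potential_sub_le hs hs1 hk hkM hkr (by rw [mem_ball] at hx; linarith)
  refine (setLIntegral_mono' measurableSet_ball hpt).trans ?_
  have hm1 : Measurable fun x ↦ μ (ball z (4 * r) \ ball x (2 * r)) := by
    have : MeasurableSet {q : EuclideanSpace ℝ (Fin (m + 1)) × EuclideanSpace ℝ (Fin (m + 1)) |
        q.2 ∈ ball z (4 * r) ∧ ¬ dist q.2 q.1 < 2 * r} :=
      (measurable_snd measurableSet_ball).inter (measurableSet_dist_lt (2 * r)).compl
    exact measurable_measure_prodMk_left this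
  have hm2 : Measurable (Function.uncurry fun x y ↦ ‖k (x - y) - k (x - z)‖ₑ) :=
    ((hk.comp (measurable_fst.sub measurable_snd)).sub
      (hk.comp (measurable_fst.sub_const z))).enorm
  have hm3 : Measurable fun x ↦ ∫⁻ y in ball z (4 * r), ‖k (x - y) - k (x - z)‖ₑ ∂μ :=
    hm2.lintegral_prod_right'
  have hm4 : Measurable fun x ↦ ENNReal.ofReal M * μ (ball z (4 * r) \ ball x (2 * r)) +
      ∫⁻ y in ball z (4 * r), ‖k (x - y) - k (x - z)‖ₑ ∂μ := (hm1.const_mul _).add hm3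
  rw [lintegral_const_mul _ hm4,
    lintegral_add_left (hm1.const_mul _), lintegral_const_mul _ hm1]
  -- After exchanging integrals, a fixed `y` contributes the volume of `ball z (2r)` outside `ball y
  -- (2r)`, which is linear in `dist y z`.
  have hI1 : ∫⁻ x in ball z (2 * r), μ (ball z (4 * r) \ ball x (2 * r)) ≤
      ENNReal.ofReal (2 ^ m * unitVol (m + 1) * (m + 1) * r ^ (m + 1)) *
        ∫⁻ y in ball z (4 * r), ENNReal.ofReal (dist y z / r) ∂μ := by
    have e1 : ∀ x, μ (ball z (4 * r) \ ball x (2 * r)) = ∫⁻ y in ball z (4 * r),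
        {q : EuclideanSpace ℝ (Fin (m + 1)) × EuclideanSpace ℝ (Fin (m + 1)) |
          dist q.2 q.1 < 2 * r}ᶜ.indicator (fun _ ↦ (1 : ℝ≥0∞)) (x, y) ∂μ := by
      intro x
      have : ∀ y, {q : EuclideanSpace ℝ (Fin (m + 1)) × EuclideanSpace ℝ (Fin (m + 1)) |
          dist q.2 q.1 < 2 * r}ᶜ.indicator (fun _ ↦ (1 : ℝ≥0∞)) (x, y) = (ball x (2 * r))ᶜ.indicator (fun _ ↦ (1 : ℝ≥0∞)) y :=
        fun y ↦ rfl
      simp_rw [this]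
      rw [lintegral_indicator_const measurableSet_ball.compl, one_mul,
        Measure.restrict_apply measurableSet_ball.compl, inter_comm, sdiff_eq]
    simp_rw [e1]
    rw [lintegral_lintegral_swap, ← lintegral_const_mul' _ _ ENNReal.ofReal_ne_top]
    · refine lintegral_mono fun y ↦ ?_
      have : ∀ x, {q : EuclideanSpace ℝ (Fin (m + 1)) × EuclideanSpace ℝ (Fin (m + 1)) |
          dist q.2 q.1 < 2 * r}ᶜ.indicator (fun _ ↦ (1 : ℝ≥0∞)) (x, y) = (ball y (2 * r))ᶜ.indicator (fun _ ↦ (1 : ℝ≥0∞)) x := by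
        intro x
        have h : (x, y) ∈ {q : EuclideanSpace ℝ (Fin (m + 1)) × EuclideanSpace ℝ (Fin (m + 1)) |
            dist q.2 q.1 < 2 * r}ᶜ ↔ x ∈ (ball y (2 * r))ᶜ := by
          rw [mem_compl_iff, mem_compl_iff, mem_ball, dist_comm x y]; rfl
        by_cases hx : x ∈ (ball y (2 * r))ᶜ
        · rw [indicator_of_mem hx, indicator_of_mem (h.2 hx)]
        · rw [indicator_of_notMem hx, indicator_of_notMem (mt h.1 hx)]
      simp_rw [this]
      rw [lintegral_indicator_const measurableSet_ball.compl, one_mul,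
        Measure.restrict_apply measurableSet_ball.compl, inter_comm, ← sdiff_eq]
      refine (volume_ball_diff_ball_le' z y (by positivity)).trans ?_
      rw [← ENNReal.ofReal_mul (by positivity), dist_comm]
      refine ENNReal.ofReal_le_ofReal (le_of_eq ?_)
      rw [mul_pow]
      field_simp
      ring
    · exact (measurable_const.indicator (measurableSet_dist_lt _).compl).aemeasurable
  have hI2 : ∫⁻ x in ball z (2 * r), ∫⁻ y in ball z (4 * r), ‖k (x - y) - k (x - z)‖ₑ ∂μ ≤
      ENNReal.ofReal (B * M * r ^ (m + 1)) *
        ∫⁻ y in ball z (4 * r), ENNReal.ofReal (dist y z / r) ∂μ := by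
    rw [lintegral_lintegral_swap hm2.aemeasurable, ← lintegral_const_mul' _ _ ENNReal.ofReal_ne_top]
    refine lintegral_mono fun y ↦ (setLIntegral_le_lintegral _ _).trans ((hmod y z).trans ?_)
    rw [← ENNReal.ofReal_mul (by positivity)]
    refine ENNReal.ofReal_le_ofReal (le_of_eq ?_)
    field_simp
    ring
  refine (mul_le_mul_right (add_le_add (mul_le_mul_right hI1 _) hI2) _).trans ?_
  rw [← mul_assoc, ← add_mul, ← mul_assoc]
  gcongr
  rw [← ENNReal.ofReal_mul hM, ← ENNReal.ofReal_add (by positivity) (by positivity),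
    ← ENNReal.ofReal_mul hc0]
  refine ENNReal.ofReal_le_ofReal (le_of_eq ?_)
  have hMp : M ^ p = M ^ (p - 1) * M := by
    rw [← Real.rpow_add_one' hM (by linarith), sub_add_cancel]
  rw [hc, hMp]
  ring

/-- The part of the energy attributed to the point `z`. -/
theorem enorm_setIntegral_local_le (hΦ : HomLipschitz L p Φ) (hp : 1 < p) (hL : 0 ≤ L)
    (hM : 0 ≤ M) (hr : 0 < r) (hB : 0 ≤ B) (hs : Measurable s) (hs1 : ∀ y, |s y| ≤ 1)
    (hk : Measurable k) (hkM : ∀ u, ‖k u‖ ≤ M) (hkr : ∀ u, r ≤ ‖u‖ → k u = 0)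
    (hmod : ∀ y z, ∫⁻ x, ‖k (x - y) - k (x - z)‖ₑ ≤ ENNReal.ofReal (B * M * r ^ m * dist y z))
    (hμ : μ univ ≤ 1) {Ω : Set (EuclideanSpace ℝ (Fin (m + 1)))} (hΩ : MeasurableSet Ω)
    (z : EuclideanSpace ℝ (Fin (m + 1))) :
    ‖∫ x in Ω ∩ ball z (2 * r), Φ (potential μ s k x) / μ.real (ball x (2 * r))‖ₑ ≤
      ‖∫ x in Ω, Φ (k (x - z))‖ₑ + ‖∫ x in Ω, Φ (-k (x - z))‖ₑ +
    ENNReal.ofReal (L * (2 ^ m * unitVol (m + 1) * (m + 1) + B) * (M ^ p * r ^ (m + 1))) *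
      (μ (ball z (4 * r)) ^ (-(2 - min p 2)) *
      ∫⁻ y in ball z (4 * r), ENNReal.ofReal (dist y z / r) ∂μ) := by
  have hω := unitVol_nonneg (m + 1)
  have hsubx : ∀ x ∈ ball z (2 * r), ball x (2 * r) ⊆ ball z (4 * r) := fun x hx ↦
    ball_subset_ball' (by rw [mem_ball] at hx; linarith)
  have hN1 : μ.real (ball z (4 * r)) ≤ 1 := by
    refine ENNReal.toReal_le_of_le_ofReal zero_le_one ?_
    rw [ENNReal.ofReal_one]
    exact (measure_mono (subset_univ _)).trans hμ
  rcases (measureReal_nonneg (μ := μ) (s := ball z (4 * r))).eq_or_lt with hN | hN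
  · have h0 : ∫ x in Ω ∩ ball z (2 * r), Φ (potential μ s k x) / μ.real (ball x (2 * r)) = 0 := by
      refine setIntegral_eq_zero_of_forall_eq_zero fun x hx ↦ ?_
      have h1 : μ.real (ball x (2 * r)) = 0 :=
        le_antisymm ((measureReal_mono (hsubx x hx.2)).trans hN.symm.le) measureReal_nonneg
      rw [h1, div_zero]
    rw [h0, enorm_zero]
    exact bot_le
  set N := μ.real (ball z (4 * r)) with hNdef
  set σ := ∫ y in ball z (4 * r), s y ∂μ with hσ
  have hσN : |σ| ≤ N := by
    have h1 := norm_setIntegral_le_of_norm_le_const (μ := μ) (s := ball z (4 * r)) (f := s) (C := 1)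
      (measure_lt_top _ _) (fun y _ ↦ hs1 y)
    rwa [one_mul] at h1
  have hmain : ‖∫ x in Ω ∩ ball z (2 * r), Φ (σ • k (x - z)) / N‖ₑ ≤
      ‖∫ x in Ω, Φ (k (x - z))‖ₑ + ‖∫ x in Ω, Φ (-k (x - z))‖ₑ := by
    have h1 : ∫ x in Ω ∩ ball z (2 * r), Φ (σ • k (x - z)) / N =
        ∫ x in Ω, Φ (σ • k (x - z)) / N := by
      refine (setIntegral_eq_of_subset_of_forall_sdiff_eq_zero hΩ inter_subset_left
        fun x hx ↦ ?_).symm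
      rw [hkr, smul_zero, hΦ.zero, zero_div]
      have : ¬ dist x z < 2 * r := fun h ↦ hx.2 ⟨hx.1, h⟩
      rw [dist_eq_norm] at this
      linarith
    -- Uses `N ≤ 1` and `p > 1`: `t^p ≤ t ≤ N`. The sign of `σ` decides whether `Φ(k)` or `Φ(-k)`
    -- appears, which is why both cancellation conditions are needed.
    have hcoef : ∀ t : ℝ, 0 < t → t ≤ N → ‖t ^ p / N‖ₑ ≤ 1 := by
      intro t ht htN
      rw [← ofReal_norm, Real.norm_eq_abs, abs_of_nonneg (by positivity)]
      refine ENNReal.ofReal_le_one.2 ((div_le_one hN).2 ?_)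
      calc t ^ p ≤ t ^ (1 : ℝ) := Real.rpow_le_rpow_of_exponent_ge ht (htN.trans hN1) hp.le
        _ ≤ N := by rwa [Real.rpow_one]
    rw [h1]
    rcases lt_trichotomy σ 0 with hσ0 | hσ0 | hσ0
    · have h2 : ∀ x, Φ (σ • k (x - z)) / N = ((-σ) ^ p / N) * Φ (-k (x - z)) := fun x ↦ by
        rw [← neg_smul_neg, hΦ.smul _ (neg_pos.2 hσ0)]; ring
      simp_rw [h2]
      rw [integral_const_mul, enorm_mul]
      refine le_add_left (mul_le_of_le_one_left' (hcoef _ (neg_pos.2 hσ0) ?_))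
      rwa [abs_of_neg hσ0] at hσN
    · simp [hσ0, hΦ.zero]
    · have h2 : ∀ x, Φ (σ • k (x - z)) / N = (σ ^ p / N) * Φ (k (x - z)) := fun x ↦ by
        rw [hΦ.smul _ hσ0]; ring
      simp_rw [h2]
      rw [integral_const_mul, enorm_mul]
      refine le_add_right (mul_le_of_le_one_left' (hcoef _ hσ0 ?_))
      rwa [abs_of_pos hσ0] at hσN
  have hfin : volume (Ω ∩ ball z (2 * r)) < ⊤ :=
    (measure_mono inter_subset_right).trans_lt measure_ball_lt_top
  have hfin' : IsFiniteMeasure (volume.restrict (Ω ∩ ball z (2 * r))) :=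
    ⟨by rwa [Measure.restrict_apply_univ]⟩
  have hms : MeasurableSet (Ω ∩ ball z (2 * r)) := hΩ.inter measurableSet_ball
  have hint1 : IntegrableOn (fun x ↦ Φ (σ • k (x - z)) / N) (Ω ∩ ball z (2 * r)) := by
    refine Integrable.of_bound (C := L * (|σ| * M) ^ p / N)
      ((hΦ.measurable.comp ((hk.comp (measurable_id.sub_const z)).const_smul σ)).div_const
        N).aestronglyMeasurable (Eventually.of_forall fun x ↦ ?_)
    rw [Real.norm_eq_abs, abs_div, abs_of_pos hN]
    gcongr
    refine (hΦ.abs_le hp _).trans ?_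
    rw [norm_smul, Real.norm_eq_abs]
    gcongr
    exact hkM _
  have hint2 : IntegrableOn (fun x ↦ Φ (potential μ s k x) / μ.real (ball x (2 * r)))
      (Ω ∩ ball z (2 * r)) := by
    refine Integrable.of_bound (C := L * M ^ p)
      ((hΦ.measurable.comp (measurable_potential hs hk)).div
        (measurable_measureReal_ball μ _)).aestronglyMeasurable
      ((ae_restrict_iff' hms).2 (Eventually.of_forall fun x hx ↦ ?_))
    have hV0 := measureReal_nonneg (μ := μ) (s := ball x (2 * r))
    have hV1 : μ.real (ball x (2 * r)) ≤ 1 := (measureReal_mono (hsubx x hx.2)).trans hN1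
    rw [Real.norm_eq_abs, abs_div, abs_of_nonneg hV0]
    refine div_le_of_le_mul₀ hV0 (by positivity) ((hΦ.abs_le hp _).trans ?_)
    rw [mul_assoc]
    gcongr
    refine (Real.rpow_le_rpow (norm_nonneg _) (norm_potential_le hs1 hkM hkr
      (ρ := 2 * r) (by linarith) x) (by linarith)).trans ?_
    rw [Real.mul_rpow hM hV0]
    gcongr
    exact Real.rpow_le_self_of_le_one hV0 hV1 hp.le
  have herr := lintegral_enorm_sub_pointMass_le hΦ hp hL hM hr hB hs hs1 hk hkM hkr hmod z hN
  have hsplit : ∫ x in Ω ∩ ball z (2 * r), Φ (potential μ s k x) / μ.real (ball x (2 * r)) =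
      (∫ x in Ω ∩ ball z (2 * r), Φ (σ • k (x - z)) / N) +
      ∫ x in Ω ∩ ball z (2 * r), (Φ (potential μ s k x) / μ.real (ball x (2 * r)) -
        Φ (σ • k (x - z)) / N) := by
    rw [integral_sub hint2 hint1, add_sub_cancel]
  rw [hsplit]
  refine (enorm_add_le _ _).trans (add_le_add hmain ?_)
  refine (enorm_integral_le_lintegral_enorm _).trans
    ((lintegral_mono_set inter_subset_right).trans (herr.trans ?_))
  rw [ENNReal.ofReal_mul (by positivity), mul_assoc]
  gcongr
  rw [show μ (ball z (4 * r)) = ENNReal.ofReal N by rw [hNdef, ofReal_measureReal],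
    ENNReal.ofReal_rpow_of_pos hN]
  -- As `N ≤ 1`, the exponent `p - 2` may be lowered to `min p 2 - 2`, whose negative lies in
  -- `[0,1)` as the non-concentration estimate requires.
  refine ENNReal.ofReal_le_ofReal (Real.rpow_le_rpow_of_exponent_ge hN hN1 ?_)
  linarith [min_le_left p 2]

end SingleScale

/-! ### Distributing the energy among points and summing over scales -/

section AllScales

/-- The lower integral is superadditive for arbitrary functions. Only this inequality is used, so
measurability in `z` of the local energies need not be checked. -/
lemma tsum_lintegral_le {X ι : Type*} [MeasurableSpace X] (μ : Measure X) (F : ι → X → ℝ≥0∞) :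
    ∑' i, ∫⁻ x, F i x ∂μ ≤ ∫⁻ x, ∑' i, F i x ∂μ := by
  classical
  rw [ENNReal.tsum_eq_iSup_sum]
  refine iSup_le fun t ↦ ?_
  have h : ∑ i ∈ t, ∫⁻ x, F i x ∂μ ≤ ∫⁻ x, ∑ i ∈ t, F i x ∂μ := by
    induction t using Finset.induction_on with
    | empty => simp
    | insert a t ha ih =>
      simp only [Finset.sum_insert ha]
      exact (add_le_add le_rfl ih).trans (le_lintegral_add _ _)
  exact h.trans (lintegral_mono fun x ↦ ENNReal.sum_le_tsum t)

variable {m l : ℕ} {μ : Measure (EuclideanSpace ℝ (Fin (m + 1)))} [IsFiniteMeasure μ]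
  {s : EuclideanSpace ℝ (Fin (m + 1)) → ℝ}
  {k : EuclideanSpace ℝ (Fin (m + 1)) → EuclideanSpace ℝ (Fin l)}
  {M r p L B : ℝ} {Φ : EuclideanSpace ℝ (Fin l) → ℝ}

lemma integrableOn_comp_potential (hΦ : HomLipschitz L p Φ) (hp : 1 < p) (hL : 0 ≤ L)
    (hM : 0 ≤ M) (hs : Measurable s) (hs1 : ∀ y, |s y| ≤ 1)
    (hk : Measurable k) (hkM : ∀ u, ‖k u‖ ≤ M) (hkr : ∀ u, r ≤ ‖u‖ → k u = 0)
    {Ω : Set (EuclideanSpace ℝ (Fin (m + 1)))} (hΩf : volume Ω ≠ ⊤) :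
    IntegrableOn (fun x ↦ Φ (potential μ s k x)) Ω := by
  have : IsFiniteMeasure (volume.restrict Ω) := ⟨by
    rw [Measure.restrict_apply_univ]; exact hΩf.lt_top⟩
  refine Integrable.of_bound (C := L * (M * μ.real univ) ^ p)
    (hΦ.measurable.comp (measurable_potential hs hk)).aestronglyMeasurable
    (Eventually.of_forall fun x ↦ ?_)
  refine (hΦ.abs_le hp _).trans ?_
  gcongr
  exact (norm_potential_le hs1 hkM hkr le_rfl x).trans
    (mul_le_mul_of_nonneg_left (measureReal_mono (subset_univ _)) hM)

/-- The energy is distributed among the points of the support of the measure. -/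
theorem enorm_setIntegral_potential_le (hΦ : HomLipschitz L p Φ) (hp : 1 < p) (hL : 0 ≤ L)
    (hM : 0 ≤ M) (hr : 0 < r) (hs : Measurable s) (hs1 : ∀ y, |s y| ≤ 1)
    (hk : Measurable k) (hkM : ∀ u, ‖k u‖ ≤ M) (hkr : ∀ u, r ≤ ‖u‖ → k u = 0)
    (hμ : μ univ ≤ 1) {Ω : Set (EuclideanSpace ℝ (Fin (m + 1)))}
    (hΩf : volume Ω ≠ ⊤) :
    ‖∫ x in Ω, Φ (potential μ s k x)‖ₑ ≤ ∫⁻ z, ‖∫ x in Ω ∩ ball z (2 * r),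
      Φ (potential μ s k x) / μ.real (ball x (2 * r))‖ₑ ∂μ := by
  have hfin : IsFiniteMeasure (volume.restrict Ω) := ⟨by
    rw [Measure.restrict_apply_univ]; exact hΩf.lt_top⟩
  set h : EuclideanSpace ℝ (Fin (m + 1)) → ℝ :=
    fun x ↦ Φ (potential μ s k x) / μ.real (ball x (2 * r)) with hh
  have hhm : Measurable h := (hΦ.measurable.comp (measurable_potential hs hk)).div
    (measurable_measureReal_ball μ _)
  have hhb : ∀ x, |h x| ≤ L * M ^ p := by
    intro x
    have hV0 := measureReal_nonneg (μ := μ) (s := ball x (2 * r))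
    have hV1 : μ.real (ball x (2 * r)) ≤ 1 := by
      refine ENNReal.toReal_le_of_le_ofReal zero_le_one ?_
      rw [ENNReal.ofReal_one]
      exact (measure_mono (subset_univ _)).trans hμ
    rw [hh, abs_div, abs_of_nonneg hV0]
    refine div_le_of_le_mul₀ hV0 (by positivity) ((hΦ.abs_le hp _).trans ?_)
    rw [mul_assoc]
    gcongr
    refine (Real.rpow_le_rpow (norm_nonneg _) (norm_potential_le hs1 hkM hkr
      (ρ := 2 * r) (by linarith) x) (by linarith)).trans ?_
    rw [Real.mul_rpow hM hV0]
    gcongr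
    exact Real.rpow_le_self_of_le_one hV0 hV1 hp.le
  set D : Set (EuclideanSpace ℝ (Fin (m + 1)) × EuclideanSpace ℝ (Fin (m + 1))) :=
    {q | dist q.2 q.1 < 2 * r} with hD
  have hDm : MeasurableSet D := measurableSet_dist_lt _
  have hint : Integrable (Function.uncurry fun x z ↦ D.indicator (fun q ↦ h q.1) (x, z))
      ((volume.restrict Ω).prod μ) := by
    refine Integrable.of_bound (C := L * M ^ p)
      ((hhm.comp measurable_fst).indicator hDm).aestronglyMeasurable
      (Eventually.of_forall fun q ↦ ?_)
    change ‖D.indicator (fun q ↦ h q.1) q‖ ≤ _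
    exact (norm_indicator_le_norm_self _ _).trans (hhb q.1)
  -- Integrating the constant `h x` over `ball x (2r)` multiplies it by the mass in its denominator;
  -- where that mass is zero the potential is zero as well.
  have h1 : ∀ x, Φ (potential μ s k x) = ∫ z, D.indicator (fun q ↦ h q.1) (x, z) ∂μ := by
    intro x
    have e : (fun z ↦ D.indicator (fun q ↦ h q.1) (x, z)) =
        (ball x (2 * r)).indicator fun _ ↦ h x := rfl
    rw [e, integral_indicator_const _ measurableSet_ball, smul_eq_mul, hh]
    rcases eq_or_ne (μ.real (ball x (2 * r))) 0 with h0 | h0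
    · have := norm_potential_le hs1 hkM hkr (ρ := 2 * r) (by linarith) x (μ := μ)
      rw [h0, mul_zero] at this
      rw [norm_le_zero_iff.1 this, hΦ.zero, h0, zero_mul]
    · field_simp
  have h2 : ∀ z, ∫ x in Ω ∩ ball z (2 * r), h x =
      ∫ x in Ω, D.indicator (fun q ↦ h q.1) (x, z) := by
    intro z
    rw [← setIntegral_indicator measurableSet_ball]
    refine integral_congr_ae (Eventually.of_forall fun x ↦ ?_)
    have hx : (x, z) ∈ D ↔ x ∈ ball z (2 * r) := by
      rw [mem_ball, dist_comm]; rfl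
    by_cases hx' : x ∈ ball z (2 * r)
    · simp only [indicator_of_mem hx', indicator_of_mem (hx.2 hx')]
    · simp only [indicator_of_notMem hx', indicator_of_notMem (mt hx.1 hx')]
  simp_rw [h1, h2]
  rw [integral_integral_swap hint]
  exact enorm_integral_le_lintegral_enorm _

/-- Summation over all dyadic scales, given a uniform bound for point masses. -/
theorem exists_tsum_enorm_setIntegral_potential_le (hΦ : HomLipschitz L p Φ) (hp : 1 < p)
    (hL : 0 ≤ L) (hB : 0 ≤ B) {A : ℝ}
    {k : ℤ → EuclideanSpace ℝ (Fin (m + 1)) → EuclideanSpace ℝ (Fin l)} {M : ℤ → ℝ}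
    (hM : ∀ n, 0 ≤ M n) (hMA : ∀ n : ℤ, M n ^ p * (2 ^ (-n)) ^ (m + 1) ≤ A)
    (hk : ∀ n, Measurable (k n)) (hkM : ∀ n u, ‖k n u‖ ≤ M n)
    (hkr : ∀ n u, (2 : ℝ) ^ (-n) ≤ ‖u‖ → k n u = 0)
    (hmod : ∀ n y z, ∫⁻ x, ‖k n (x - y) - k n (x - z)‖ₑ ≤
      ENNReal.ofReal (B * M n * (2 ^ (-n)) ^ m * dist y z))
    {Ω : Set (EuclideanSpace ℝ (Fin (m + 1)))} (hΩ : MeasurableSet Ω) (hΩf : volume Ω ≠ ⊤)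
    {C : ℝ≥0∞} (hC : C ≠ ⊤)
    (hpoint : ∀ z, ∑' n, (‖∫ x in Ω, Φ (k n (x - z))‖ₑ + ‖∫ x in Ω, Φ (-k n (x - z))‖ₑ) ≤ C) :
    ∃ C' : ℝ≥0∞, C' ≠ ⊤ ∧ ∀ (μ : Measure (EuclideanSpace ℝ (Fin (m + 1))))
      (s : EuclideanSpace ℝ (Fin (m + 1)) → ℝ), μ univ ≤ 1 → Measurable s → (∀ y, |s y| ≤ 1) →
      ∑' n, ‖∫ x in Ω, Φ (potential μ s (k n) x)‖ₑ ≤ C' := by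
  have hω := unitVol_nonneg (m + 1)
  have hp2 : 1 < min p 2 := lt_min hp one_lt_two
  obtain ⟨C₁, hC₁, h₁⟩ := exists_tsum_nonconcentration_le (s := 2 - min p 2)
    (by linarith [min_le_right p 2]) (by linarith)
  refine ⟨C + ENNReal.ofReal (L * (2 ^ m * unitVol (m + 1) * (m + 1) + B) * A) * C₁,
    ENNReal.add_ne_top.2 ⟨hC, ENNReal.mul_ne_top ENNReal.ofReal_ne_top hC₁⟩,
    fun μ s hμ hs hs1 ↦ ?_⟩
  have : IsFiniteMeasure μ := ⟨hμ.trans_lt ENNReal.one_lt_top⟩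
  have hterm : ∀ n, ‖∫ x in Ω, Φ (potential μ s (k n) x)‖ₑ ≤
      ∫⁻ z, ((‖∫ x in Ω, Φ (k n (x - z))‖ₑ + ‖∫ x in Ω, Φ (-k n (x - z))‖ₑ) +
        ENNReal.ofReal (L * (2 ^ m * unitVol (m + 1) * (m + 1) + B) * A) *
        (μ (ball z (4 * 2 ^ (-n))) ^ (-(2 - min p 2)) *
          ∫⁻ y in ball z (4 * 2 ^ (-n)), ENNReal.ofReal (dist y z / 2 ^ (-n)) ∂μ)) ∂μ := by
    intro n
    have hr : (0 : ℝ) < 2 ^ (-n) := by positivity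
    refine (enorm_setIntegral_potential_le hΦ hp hL (hM n) hr hs hs1 (hk n) (hkM n) (hkr n) hμ
      hΩf).trans (lintegral_mono fun z ↦ ?_)
    refine (enorm_setIntegral_local_le hΦ hp hL (hM n) hr hB hs hs1 (hk n) (hkM n) (hkr n)
      (hmod n) hμ hΩ z).trans ?_
    gcongr
    exact hMA n
  refine (ENNReal.tsum_le_tsum hterm).trans ((tsum_lintegral_le μ _).trans ?_)
  calc _ ≤ ∫⁻ _, (C + ENNReal.ofReal (L * (2 ^ m * unitVol (m + 1) * (m + 1) + B) * A) * C₁) ∂μ := by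
        refine lintegral_mono fun z ↦ ?_
        rw [ENNReal.tsum_add, ENNReal.tsum_mul_left]
        gcongr
        · exact hpoint z
        · exact h₁ μ z hμ
    _ ≤ _ := by
        rw [lintegral_const]
        exact mul_le_of_le_one_right' hμ

end AllScales

/-! ### Flatness of a `C^{1,β}` boundary and half-space comparison -/

section Boundary

/-- `Ω` is `C r ^ (1 + β)`-close to a half-space through `z` in the ball of radius `ε` about `z`. -/
def FlatAt {d : ℕ} (β ε C : ℝ) (Ω : Set (EuclideanSpace ℝ (Fin d)))
    (z : EuclideanSpace ℝ (Fin d)) : Prop :=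
  ∃ ν : EuclideanSpace ℝ (Fin d), ‖ν‖ = 1 ∧ ∀ x, dist x z < ε →
    (C * dist x z ^ (1 + β) < ⟪ν, x - z⟫ → x ∈ Ω) ∧
    (⟪ν, x - z⟫ < -(C * dist x z ^ (1 + β)) → x ∉ Ω)

lemma FlatAt.mono {d : ℕ} {β ε ε' C C' : ℝ} {Ω : Set (EuclideanSpace ℝ (Fin d))}
    {z : EuclideanSpace ℝ (Fin d)} (h : FlatAt β ε C Ω z) (hε : ε' ≤ ε) (hC : C ≤ C') :
    FlatAt β ε' C' Ω z := by
  obtain ⟨ν, hν, hx⟩ := h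
  refine ⟨ν, hν, fun x hxz ↦ ?_⟩
  have h1 : C * dist x z ^ (1 + β) ≤ C' * dist x z ^ (1 + β) := by gcongr
  exact ⟨fun h ↦ (hx x (hxz.trans_le hε)).1 (h1.trans_lt h),
    fun h ↦ (hx x (hxz.trans_le hε)).2 (h.trans_le (neg_le_neg h1))⟩

/-- First-order Taylor estimate: along the segment the derivative differs from its value at `a` by
at most `C ‖b - a‖^β`, and the mean value inequality applies. -/
lemma norm_sub_sub_fderiv_le_of_holderOnWith {E : Type*} [NormedAddCommGroup E]
    [NormedSpace ℝ E] {h : E → ℝ} {U : Set E} {C β : ℝ≥0} (hU : Convex ℝ U)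
    (hd : ∀ y ∈ U, DifferentiableAt ℝ h y) (hH : HolderOnWith C β (fderiv ℝ h) U) {a b : E}
    (ha : a ∈ U) (hb : b ∈ U) :
    |h b - h a - fderiv ℝ h a (b - a)| ≤ C * ‖b - a‖ ^ (1 + (β : ℝ)) := by
  have hsub : segment ℝ a b ⊆ U := hU.segment_subset ha hb
  have h1 := Convex.norm_image_sub_le_of_norm_hasFDerivWithin_le' (f := h) (φ := fderiv ℝ h a)
    (s := segment ℝ a b) (f' := fderiv ℝ h) (C := C * ‖b - a‖ ^ (β : ℝ))
    (fun x hx ↦ (hd x (hsub hx)).hasFDerivAt.hasFDerivWithinAt) (fun x hx ↦ ?_)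
    (convex_segment a b) (left_mem_segment ℝ a b) (right_mem_segment ℝ a b)
  · rw [Real.norm_eq_abs, mul_assoc] at h1
    refine h1.trans ?_
    gcongr
    rcases (norm_nonneg (b - a)).eq_or_lt with h0 | h0
    · rw [← h0, mul_zero]; positivity
    · rw [Real.rpow_add h0, Real.rpow_one, mul_comm]
  · have h2 := hH.dist_le (hsub hx) ha
    rw [dist_eq_norm] at h2
    refine h2.trans ?_
    gcongr
    exact (convex_closedBall a ‖b - a‖).segment_subset (mem_closedBall_self (norm_nonneg _))
      (by rw [mem_closedBall, dist_eq_norm]) hx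

/-- The normal at `z` is the gradient `w` of the defining function `⟪ν,x⟫ - h(Px)`, and the Taylor
remainder of `h` is the flatness error. Halving the chart radius keeps balls about nearby boundary
points inside the chart. -/
lemma HasC1HolderBoundary.exists_flatAt_nhds {d : ℕ} {β : ℝ≥0}
    {Ω : Set (EuclideanSpace ℝ (Fin d))} (hΩ : HasC1HolderBoundary β Ω) (hΩo : IsOpen Ω)
    {z₀ : EuclideanSpace ℝ (Fin d)} (hz₀ : z₀ ∈ frontier Ω) :
    ∃ ε C : ℝ, 0 < ε ∧ 0 ≤ C ∧ ∀ z ∈ frontier Ω ∩ ball z₀ ε, FlatAt β ε C Ω z := by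
  obtain ⟨r, hr, ν, hν, h, C, hd, hH, hΩr⟩ := hΩ z₀ hz₀
  set P := (ℝ ∙ ν)ᗮ.orthogonalProjectionOnto with hP
  have hPle : ∀ x y, ‖P x - P y‖ ≤ dist x y := fun x y ↦ by
    rw [← map_sub, dist_eq_norm]
    exact Submodule.norm_orthogonalProjectionOnto_apply_le _ _
  refine ⟨r / 2, C, by positivity, C.2, ?_⟩
  rintro z ⟨hz, hzz⟩
  rw [mem_ball] at hzz
  have hzr : z ∈ ball z₀ r := by rw [mem_ball]; linarith
  have hPU : ∀ x ∈ ball z₀ r, P x ∈ ball (P z₀) r := fun x hx ↦ by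
    rw [mem_ball, dist_eq_norm]
    exact (hPle _ _).trans_lt hx
  have hcont : ContinuousAt (fun x ↦ h (P x)) z :=
    ContinuousAt.comp (hd _ (hPU z hzr)).continuousAt P.continuous.continuousAt
  -- A boundary point lies on the graph: above it the point would be in the open set `Ω`, strictly
  -- below it a whole neighbourhood would miss `Ω`.
  have hgraph : h (P z) = ⟪ν, z⟫ := by
    have hzc : z ∈ closure Ω := frontier_subset_closure hz
    have hzn : z ∉ Ω := by
      rw [hΩo.frontier_eq] at hz; exact hz.2
    refine le_antisymm ?_ (not_lt.1 fun hlt ↦ hzn ((hΩr z hzr).2 hlt))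
    by_contra hlt
    rw [not_le] at hlt
    have hin : ContinuousAt (fun x : EuclideanSpace ℝ (Fin d) ↦ ⟪ν, x⟫) z :=
      (continuous_const.inner continuous_id).continuousAt
    have h1 : ∀ᶠ x in 𝓝 z, x ∉ Ω := by
      filter_upwards [hin.eventually_lt hcont hlt, isOpen_ball.mem_nhds hzr] with x hx1 hx2 hx3
      exact absurd ((hΩr x hx2).1 hx3) (not_lt.2 hx1.le)
    exact (mem_closure_iff_frequently.1 hzc) h1
  set Λ : EuclideanSpace ℝ (Fin d) →L[ℝ] ℝ :=
    innerSL ℝ ν - (fderiv ℝ h (P z)).comp P with hΛ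
  set w := (InnerProductSpace.toDual ℝ (EuclideanSpace ℝ (Fin d))).symm Λ with hw
  have hwΛ : ∀ v, ⟪w, v⟫ = Λ v := fun v ↦ InnerProductSpace.toDual_symm_apply
  -- Since `P ν = 0`, the pairing of `w` with `ν` is one; normalizing `w` therefore does not enlarge
  -- the error constant.
  have hw1 : 1 ≤ ‖w‖ := by
    have h1 : ⟪w, ν⟫ = 1 := by
      rw [hwΛ, hΛ]
      have : P ν = 0 := Submodule.orthogonalProjectionOnto_orthogonal_apply_eq_zero
        (Submodule.mem_span_singleton_self ν)
      simp [this, hν]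
    have h2 := real_inner_le_norm w ν
    rwa [h1, hν, mul_one] at h2
  have hw0 : 0 < ‖w‖ := by linarith
  refine ⟨‖w‖⁻¹ • w, by rw [norm_smul, norm_inv, norm_norm, inv_mul_cancel₀ hw0.ne'], fun x hx ↦ ?_⟩
  have hxr : x ∈ ball z₀ r := by
    rw [mem_ball]; linarith [dist_triangle x z z₀]
  have hT := norm_sub_sub_fderiv_le_of_holderOnWith (convex_ball _ _) hd hH (hPU z hzr) (hPU x hxr)
  have hT2 : |h (P x) - h (P z) - fderiv ℝ h (P z) (P x - P z)| ≤
      C * dist x z ^ (1 + (β : ℝ)) := by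
    refine hT.trans ?_
    gcongr
    exact hPle x z
  have hΛx : ⟪w, x - z⟫ = ⟪ν, x⟫ - ⟪ν, z⟫ - fderiv ℝ h (P z) (P x - P z) := by
    rw [hwΛ, hΛ]
    simp [inner_sub_right]
  have hTabs := abs_le.1 hT2
  have hD : 0 ≤ C * dist x z ^ (1 + (β : ℝ)) := by positivity
  rw [real_inner_smul_left]
  constructor
  · intro h1
    have h2 : C * dist x z ^ (1 + (β : ℝ)) < ⟪w, x - z⟫ := by
      have h3 := (lt_inv_mul_iff₀ hw0).1 h1
      nlinarith
    rw [hΩr x hxr]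
    linarith
  · intro h1 hxΩ
    have h2 : ⟪w, x - z⟫ < -(C * dist x z ^ (1 + (β : ℝ))) := by
      have h3 := (inv_mul_lt_iff₀ hw0).1 h1
      nlinarith
    rw [hΩr x hxr] at hxΩ
    linarith

/-- A bounded open set with `C^{1,β}` boundary is uniformly flat along its boundary. -/
theorem HasC1HolderBoundary.exists_flatAt {d : ℕ} {β : ℝ≥0}
    {Ω : Set (EuclideanSpace ℝ (Fin d))} (hΩ : HasC1HolderBoundary β Ω) (hΩo : IsOpen Ω)
    (hΩb : Bornology.IsBounded Ω) :
    ∃ ε C : ℝ, 0 < ε ∧ 0 ≤ C ∧ ∀ z ∈ frontier Ω, FlatAt β ε C Ω z := by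
  have hc : IsCompact (frontier Ω) :=
    Metric.isCompact_of_isClosed_isBounded isClosed_frontier
      (hΩb.closure.subset frontier_subset_closure)
  refine hc.induction_on (p := fun s ↦ ∃ ε C : ℝ, 0 < ε ∧ 0 ≤ C ∧ ∀ z ∈ s, FlatAt β ε C Ω z)
    ⟨1, 0, one_pos, le_rfl, fun z hz ↦ hz.elim⟩ ?_ ?_ ?_
  · rintro s t hst ⟨ε, C, hε, hC, h⟩
    exact ⟨ε, C, hε, hC, fun z hz ↦ h z (hst hz)⟩
  · rintro s t ⟨ε, C, hε, hC, h⟩ ⟨ε', C', hε', hC', h'⟩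
    refine ⟨min ε ε', max C C', lt_min hε hε', hC.trans (le_max_left _ _), ?_⟩
    rintro z (hz | hz)
    · exact (h z hz).mono (min_le_left _ _) (le_max_left _ _)
    · exact (h' z hz).mono (min_le_right _ _) (le_max_right _ _)
  · intro z₀ hz₀
    obtain ⟨ε, C, hε, hC, h⟩ := hΩ.exists_flatAt_nhds hΩo hz₀
    exact ⟨frontier Ω ∩ ball z₀ ε, inter_mem_nhdsWithin _ (ball_mem_nhds z₀ hε), ε, C, hε, hC, h⟩

variable {m : ℕ} {q : EuclideanSpace ℝ (Fin (m + 1)) → ℝ} {Q r : ℝ}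

lemma integrable_of_bound_of_support (hq : Measurable q) (hqQ : ∀ u, |q u| ≤ Q)
    (hqr : ∀ u, r ≤ ‖u‖ → q u = 0) : Integrable q := by
  have h : IntegrableOn q (ball 0 r) := by
    have : IsFiniteMeasure (volume.restrict (ball (0 : EuclideanSpace ℝ (Fin (m + 1))) r)) :=
      ⟨by rw [Measure.restrict_apply_univ]; exact measure_ball_lt_top⟩
    exact Integrable.of_bound hq.aestronglyMeasurable Q (Eventually.of_forall hqQ)
  refine (integrableOn_iff_integrable_of_support_subset fun u hu ↦ ?_).1 h
  rw [mem_ball_zero_iff]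
  by_contra h'
  exact hu (hqr u (not_lt.1 h'))

/-- Points whose ball does not meet the boundary do not contribute. -/
lemma setIntegral_translate_eq_zero (hqr : ∀ u, r ≤ ‖u‖ → q u = 0) (hq0 : ∫ u, q u = 0)
    {Ω : Set (EuclideanSpace ℝ (Fin (m + 1)))} (hΩo : IsOpen Ω)
    {y : EuclideanSpace ℝ (Fin (m + 1))} (hy : Disjoint (ball y r) (frontier Ω)) :
    ∫ x in Ω, q (x - y) = 0 := by
  have hout : ∀ x, x ∉ ball y r → q (x - y) = 0 := fun x hx ↦ by
    refine hqr _ ?_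
    rwa [mem_ball, dist_eq_norm, not_lt] at hx
  have hsub : ball y r ⊆ Ω ∪ (closure Ω)ᶜ := by
    intro x hx
    by_contra h
    rw [mem_union, not_or, mem_compl_iff, not_not] at h
    refine disjoint_left.1 hy hx ?_
    rw [hΩo.frontier_eq]
    exact ⟨h.2, h.1⟩
  rcases (convex_ball y r).isPreconnected.subset_or_subset hΩo isClosed_closure.isOpen_compl
    (disjoint_left.2 fun x hx hx' ↦ hx' (subset_closure hx)) hsub with h | h
  · rw [setIntegral_eq_integral_of_forall_compl_eq_zero fun x hx ↦ hout x fun hx' ↦ hx (h hx'),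
      integral_sub_right_eq_self (fun x ↦ q x), hq0]
  · exact setIntegral_eq_zero_of_forall_eq_zero fun x hx ↦ hout x fun hx' ↦
      h hx' (subset_closure hx)

/-- The contribution of a point close to the boundary. -/
lemma abs_setIntegral_translate_le (hq : Measurable q) (hqQ : ∀ u, |q u| ≤ Q) (hr : 0 < r)
    (hqr : ∀ u, r ≤ ‖u‖ → q u = 0)
    (hqh : ∀ ν : EuclideanSpace ℝ (Fin (m + 1)), ‖ν‖ = 1 → ∫ u in {u | 0 < ⟪ν, u⟫}, q u = 0)
    {Ω : Set (EuclideanSpace ℝ (Fin (m + 1)))} (hΩo : IsOpen Ω) {β ε C : ℝ} (hβ : 0 < β)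
    (hC : 0 ≤ C) {y z : EuclideanSpace ℝ (Fin (m + 1))} (hz : FlatAt β ε C Ω z)
    (hrε : 2 * r ≤ ε) (hyz : dist y z < r) :
    |∫ x in Ω, q (x - y)| ≤
      Q * (2 ^ (m + 1) * r ^ m * (C * (2 * r) ^ (1 + β) + dist y z)) := by
  obtain ⟨ν, hν, hflat⟩ := hz
  have hQ : 0 ≤ Q := (abs_nonneg _).trans (hqQ 0)
  -- The comparison half-space passes through `y`, where the cancellation is centred, rather than
  -- through the boundary point `z`; the shift costs the term `dist y z` in the slab width.
  set H : Set (EuclideanSpace ℝ (Fin (m + 1))) := {x | 0 < ⟪ν, x - y⟫} with hH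
  have hHm : MeasurableSet H :=
    (isOpen_lt continuous_const (continuous_const.inner (continuous_sub_right y))).measurableSet
  have hqi : Integrable (fun x ↦ q (x - y)) :=
    (integrable_of_bound_of_support hq hqQ hqr).comp_sub_right y
  have hH0 : ∫ x in H, q (x - y) = 0 := by
    rw [← integral_indicator hHm]
    have h1 : (fun x ↦ H.indicator (fun x ↦ q (x - y)) x) =
        fun x ↦ {u | 0 < ⟪ν, u⟫}.indicator q (x - y) := rfl
    have hm : MeasurableSet {u : EuclideanSpace ℝ (Fin (m + 1)) | 0 < ⟪ν, u⟫} :=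
      (isOpen_lt continuous_const (continuous_const.inner continuous_id)).measurableSet
    rw [h1, integral_sub_right_eq_self (fun x ↦ {u | 0 < ⟪ν, u⟫}.indicator q x),
      integral_indicator hm, hqh ν hν]
  set t := C * (2 * r) ^ (1 + β) + dist y z with ht
  set S := {x | x ∈ ball y r ∧ |⟪ν, x⟫ - ⟪ν, z⟫| ≤ t} with hS
  have hSm : MeasurableSet S := by
    have h1 : MeasurableSet {x : EuclideanSpace ℝ (Fin (m + 1)) | |⟪ν, x⟫ - ⟪ν, z⟫| ≤ t} :=
      (isClosed_le ((continuous_const.inner continuous_id).sub continuous_const).abs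
        continuous_const).measurableSet
    exact measurableSet_ball.inter h1
  have ht0 : 0 ≤ t := by positivity
  have hSv : volume.real S ≤ 2 ^ (m + 1) * r ^ m * t :=
    ENNReal.toReal_le_of_le_ofReal (by positivity) (volume_slab_le hν y hr.le _ ht0)
  have hSf : volume S ≠ ⊤ := ((measure_mono fun x hx ↦ hx.1).trans_lt measure_ball_lt_top).ne
  have hmem : ∀ x ∈ ball y r, x ∉ S → (x ∈ Ω ↔ x ∈ H) := by
    intro x hx hxS
    have hx1 : t < |⟪ν, x - z⟫| := by
      rw [inner_sub_right]
      by_contra h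
      exact hxS ⟨hx, not_lt.1 h⟩
    rw [mem_ball] at hx
    have hxz : dist x z < 2 * r := by linarith [dist_triangle x y z]
    have hpow : C * dist x z ^ (1 + β) ≤ C * (2 * r) ^ (1 + β) := by gcongr
    have hyz' : |⟪ν, y - z⟫| ≤ dist y z := by
      refine (abs_real_inner_le_norm _ _).trans ?_
      rw [hν, one_mul, dist_eq_norm]
    have hxy : ⟪ν, x - y⟫ = ⟪ν, x - z⟫ - ⟪ν, y - z⟫ := by
      rw [← inner_sub_right, sub_sub_sub_cancel_right]
    have habs := abs_le.1 hyz'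
    have hf := hflat x (hxz.trans_le hrε)
    have hHx : x ∈ H ↔ 0 < ⟪ν, x - y⟫ := Iff.rfl
    have hp0 : 0 ≤ C * (2 * r) ^ (1 + β) := by positivity
    rcases lt_abs.1 hx1 with h1 | h1
    · exact ⟨fun _ ↦ by rw [hHx]; linarith, fun _ ↦ hf.1 (by linarith [dist_nonneg (x := y) (y := z)])⟩
    · refine ⟨fun h ↦ absurd h (hf.2 (by linarith [dist_nonneg (x := y) (y := z)])), fun h ↦ ?_⟩
      rw [hHx] at h
      linarith
  have hdiff : ∫ x in Ω, q (x - y) =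
      ∫ x, (Ω.indicator (fun x ↦ q (x - y)) x - H.indicator (fun x ↦ q (x - y)) x) := by
    rw [integral_sub (hqi.indicator hΩo.measurableSet) (hqi.indicator hHm),
      integral_indicator hΩo.measurableSet, integral_indicator hHm, hH0, sub_zero]
  rw [hdiff, ← Real.norm_eq_abs]
  have hpt : ∀ x, ‖Ω.indicator (fun x ↦ q (x - y)) x - H.indicator (fun x ↦ q (x - y)) x‖ ≤
      S.indicator (fun _ ↦ Q) x := by
    intro x
    by_cases hxS : x ∈ S
    · rw [indicator_of_mem hxS, Real.norm_eq_abs]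
      by_cases h1 : x ∈ Ω <;> by_cases h2 : x ∈ H <;> simp [h1, h2, hqQ, hQ]
    · rw [indicator_of_notMem hxS]
      by_cases hx : x ∈ ball y r
      · have := hmem x hx hxS
        by_cases h1 : x ∈ Ω
        · simp [h1, this.1 h1]
        · simp [h1, mt this.2 h1]
      · have h0 : q (x - y) = 0 := by
          refine hqr _ ?_
          rwa [mem_ball, dist_eq_norm, not_lt] at hx
        simp [indicator, h0]
  refine (norm_integral_le_of_norm_le ((integrable_indicator_iff hSm).2
    (integrableOn_const hSf)) (Eventually.of_forall hpt)).trans ?_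
  rw [integral_indicator_const _ hSm, smul_eq_mul, mul_comm]
  gcongr

end Boundary

/-! ### Uniform bound for point masses -/

section PointMass

variable {m : ℕ}

/-- Two opposite half-spaces fill the space up to a hyperplane, which is null in the support as a
slab of zero width. -/
lemma integral_eq_zero_of_half_space {q : EuclideanSpace ℝ (Fin (m + 1)) → ℝ} {Q r : ℝ}
    (hq : Measurable q) (hqQ : ∀ u, |q u| ≤ Q) (hr : 0 < r) (hqr : ∀ u, r ≤ ‖u‖ → q u = 0)
    (hqh : ∀ ν : EuclideanSpace ℝ (Fin (m + 1)), ‖ν‖ = 1 → ∫ u in {u | 0 < ⟪ν, u⟫}, q u = 0) :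
    ∫ u, q u = 0 := by
  have hqi := integrable_of_bound_of_support hq hqQ hqr
  set ν : EuclideanSpace ℝ (Fin (m + 1)) := EuclideanSpace.single 0 1
  have hν : ‖ν‖ = 1 := by simp [ν]
  have hm : ∀ ν : EuclideanSpace ℝ (Fin (m + 1)), MeasurableSet {u | 0 < ⟪ν, u⟫} := fun ν ↦
    (isOpen_lt continuous_const (continuous_const.inner continuous_id)).measurableSet
  have hnull : volume {x | x ∈ ball (0 : EuclideanSpace ℝ (Fin (m + 1))) r ∧ |⟪ν, x⟫ - 0| ≤ 0} = 0 := by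
    have := volume_slab_le hν 0 hr.le 0 (le_refl 0)
    rwa [mul_zero, ENNReal.ofReal_zero, nonpos_iff_eq_zero] at this
  have hae : ∀ᵐ u, q u = {u | 0 < ⟪ν, u⟫}.indicator q u + {u | 0 < ⟪-ν, u⟫}.indicator q u := by
    filter_upwards [measure_eq_zero_iff_ae_notMem.1 hnull] with u hu
    rcases lt_trichotomy ⟪ν, u⟫ 0 with h | h | h
    · have h1 : ¬ 0 < ⟪ν, u⟫ := not_lt.2 h.le
      have h2 : 0 < ⟪-ν, u⟫ := by rw [inner_neg_left]; linarith
      rw [indicator_of_notMem (by exact h1), indicator_of_mem (by exact h2), zero_add]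
    · have h1 : q u = 0 := by
        by_contra hne
        refine hu ⟨?_, by simp [h]⟩
        rw [mem_ball_zero_iff]
        by_contra h'
        exact hne (hqr u (not_lt.1 h'))
      simp [indicator, h1]
    · have h2 : ¬ 0 < ⟪-ν, u⟫ := by rw [inner_neg_left]; linarith
      rw [indicator_of_mem (by exact h), indicator_of_notMem (by exact h2), add_zero]
  rw [integral_congr_ae hae, integral_add (hqi.indicator (hm _)) (hqi.indicator (hm _)),
    integral_indicator (hm _), integral_indicator (hm _), hqh ν hν, hqh (-ν) (by rwa [norm_neg]),
    add_zero]

/-- The contributions of a point mass, summed over all dyadic scales, are bounded uniformly in the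
position of the point. -/
theorem exists_tsum_enorm_setIntegral_translate_le {q : ℤ → EuclideanSpace ℝ (Fin (m + 1)) → ℝ}
    {A : ℝ} (hq : ∀ n, Measurable (q n)) (hqQ : ∀ n u, |q n u| ≤ A / (2 ^ (-n)) ^ (m + 1))
    (hqr : ∀ n u, (2 : ℝ) ^ (-n) ≤ ‖u‖ → q n u = 0)
    (hqh : ∀ n, ∀ ν : EuclideanSpace ℝ (Fin (m + 1)), ‖ν‖ = 1 →
      ∫ u in {u | 0 < ⟪ν, u⟫}, q n u = 0)
    {Ω : Set (EuclideanSpace ℝ (Fin (m + 1)))} (hΩo : IsOpen Ω) (hΩb : Bornology.IsBounded Ω)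
    {β : ℝ≥0} (hβ : 0 < β) (hΩ : HasC1HolderBoundary β Ω) :
    ∃ C : ℝ≥0∞, C ≠ ⊤ ∧ ∀ y, ∑' n, ‖∫ x in Ω, q n (x - y)‖ₑ ≤ C := by
  obtain ⟨ε, C, hε, hC, hflat⟩ := hΩ.exists_flatAt hΩo hΩb
  have hA : 0 ≤ A := by
    have := (abs_nonneg _).trans (hqQ 0 0)
    simpa using this
  set v := volume.real Ω with hv
  have hv0 : 0 ≤ v := measureReal_nonneg
  have hΩf : volume Ω < ⊤ := hΩb.measure_lt_top
  obtain ⟨C₁, hC₁, h₁⟩ := exists_tsum_dyadic_le (γ := ((m + 1 : ℕ) : ℝ)) (by positivity)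
  obtain ⟨C₂, hC₂, h₂⟩ := exists_tsum_dyadic_le one_pos
  obtain ⟨C₃, hC₃, h₃⟩ := exists_tsum_dyadic_le (γ := (β : ℝ)) (by exact_mod_cast hβ)
  -- Three regimes: `a₁` for scales `r ≥ ε/2`, where only `|Ω|` is used; `a₂` for the offset `δ/r`
  -- of the point from the boundary; `a₃` for the curvature term `r^β`.
  set a₁ := A * v * (2 / ε) ^ (m + 1)
  set a₂ := A * 2 ^ (m + 1)
  set a₃ := A * 2 ^ (m + 1) * C * 2 ^ (1 + (β : ℝ)) * (ε / 2) ^ (β : ℝ)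
  refine ⟨ENNReal.ofReal a₁ * C₁ + (ENNReal.ofReal a₂ * C₂ + ENNReal.ofReal a₃ * C₃), by
    finiteness, fun y ↦ ?_⟩
  set δ := infDist y (frontier Ω) with hδ
  have hδ0 : 0 ≤ δ := infDist_nonneg
  have hterm : ∀ n : ℤ, ‖∫ x in Ω, q n (x - y)‖ₑ ≤
      ENNReal.ofReal a₁ * (if (2 : ℝ) ^ n ≤ 2 / ε then
        ENNReal.ofReal (((2 : ℝ) ^ n / (2 / ε)) ^ ((m + 1 : ℕ) : ℝ)) else 0) +
      (ENNReal.ofReal a₂ * (if (2 : ℝ) ^ n ≤ 1 / δ then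
        ENNReal.ofReal (((2 : ℝ) ^ n / (1 / δ)) ^ (1 : ℝ)) else 0) +
      ENNReal.ofReal a₃ * (if (2 : ℝ) ^ (-n) ≤ ε / 2 then
        ENNReal.ofReal (((2 : ℝ) ^ (-n) / (ε / 2)) ^ (β : ℝ)) else 0)) := by
    intro n
    have hr : (0 : ℝ) < 2 ^ (-n) := by positivity
    have hn : (2 : ℝ) ^ n = (2 ^ (-n))⁻¹ := by rw [zpow_neg, inv_inv]
    set r := (2 : ℝ) ^ (-n) with hrdef
    rw [hn]
    have hQ0 : 0 ≤ A / r ^ (m + 1) := by positivity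
    by_cases hdisj : Disjoint (ball y r) (frontier Ω)
    · rw [setIntegral_translate_eq_zero (hqr n) (integral_eq_zero_of_half_space (hq n) (hqQ n) hr
        (hqr n) (hqh n)) hΩo hdisj, enorm_zero]
      exact bot_le
    rw [← ofReal_norm, Real.norm_eq_abs]
    rcases le_or_gt ε (2 * r) with hεr | hεr
    · refine le_add_right ?_
      have h1 : r⁻¹ ≤ 2 / ε := by
        rw [inv_le_iff_one_le_mul₀ hr, div_mul_eq_mul_div, one_le_div hε]; exact hεr
      rw [if_pos h1, ← ENNReal.ofReal_mul (by positivity), Real.rpow_natCast]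
      refine ENNReal.ofReal_le_ofReal ?_
      have h2 := norm_setIntegral_le_of_norm_le_const (f := fun x ↦ q n (x - y)) hΩf
        fun x _ ↦ hqQ n (x - y)
      rw [Real.norm_eq_abs] at h2
      refine h2.trans_eq ?_
      simp only [a₁, ← hv, ← hrdef, div_pow, inv_pow]
      field_simp
    · obtain ⟨z', hz', hz'f⟩ := not_disjoint_iff.1 hdisj
      have hne : (frontier Ω).Nonempty := ⟨z', hz'f⟩
      have hc : IsCompact (frontier Ω) := Metric.isCompact_of_isClosed_isBounded isClosed_frontier
        (hΩb.closure.subset frontier_subset_closure)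
      obtain ⟨z, hz, hzδ⟩ := hc.exists_infDist_eq_dist hne y
      have hδr : δ < r := (infDist_le_dist_of_mem hz'f).trans_lt (by rwa [dist_comm])
      rw [← hδ] at hzδ
      have h1 := abs_setIntegral_translate_le (hq n) (hqQ n) hr (hqr n) (hqh n) hΩo
        (β := (β : ℝ)) (by exact_mod_cast hβ) hC (hflat z hz) hεr.le (hzδ ▸ hδr)
      rw [← hzδ] at h1
      refine le_add_left ?_
      have h2 : (A / r ^ (m + 1)) * (2 ^ (m + 1) * r ^ m * (C * (2 * r) ^ (1 + (β : ℝ)) + δ)) =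
          a₂ * (δ / r) + a₃ * (r / (ε / 2)) ^ (β : ℝ) := by
        simp only [a₂, a₃]
        rw [Real.mul_rpow zero_le_two hr.le, Real.rpow_add hr, Real.rpow_one,
          Real.div_rpow hr.le (by positivity)]
        have : (ε / 2) ^ (β : ℝ) ≠ 0 := by positivity
        field_simp
        ring
      rw [h2] at h1
      refine (ENNReal.ofReal_le_ofReal h1).trans ?_
      rw [ENNReal.ofReal_add (by positivity) (by positivity), ENNReal.ofReal_mul (by positivity),
        ENNReal.ofReal_mul (p := a₃) (by positivity)]
      refine add_le_add ?_ ?_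
      -- For `δ = 0` the offset term is zero, in agreement with `1 / δ = 0`, which makes the
      -- condition `2^n ≤ 1/δ` false.
      · rcases hδ0.eq_or_lt with h0 | h0
        · rw [← h0]; simp
        · rw [if_pos ((inv_eq_one_div r).le.trans (one_div_le_one_div_of_le h0 hδr.le)), Real.rpow_one]
          refine mul_le_mul_right (ENNReal.ofReal_le_ofReal (le_of_eq ?_)) _
          field_simp
      · rw [if_pos (by linarith)]
  refine (ENNReal.tsum_le_tsum hterm).trans ?_
  rw [ENNReal.tsum_add, ENNReal.tsum_add, ENNReal.tsum_mul_left, ENNReal.tsum_mul_left,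
    ENNReal.tsum_mul_left]
  refine add_le_add (mul_le_mul_right (h₁ _ (by positivity)) _)
    (add_le_add (mul_le_mul_right ?_ _) (mul_le_mul_right ?_ _))
  · rcases hδ0.eq_or_lt with h0 | h0
    · refine le_of_eq_of_le (ENNReal.tsum_eq_zero.2 fun n ↦ if_neg ?_) bot_le
      rw [← h0, div_zero, not_le]
      positivity
    · exact h₂ _ (by positivity)
  · refine le_of_eq_of_le ?_ (h₃ (ε / 2) (by positivity))
    exact (Equiv.neg ℤ).tsum_eq (fun n : ℤ ↦ if (2 : ℝ) ^ n ≤ ε / 2 then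
      ENNReal.ofReal (((2 : ℝ) ^ n / (ε / 2)) ^ (β : ℝ)) else 0)

end PointMass

/-! ### Bounds for homogeneous functions from their restriction to the sphere -/

section Homogeneous

/-- Mean value inequality for `t^e`. The bound `B` is a parameter because the derivative is largest
at the far end for `e = p` and at the near end for negative `e`. -/
lemma abs_rpow_sub_rpow_le {e B x y : ℝ} (hx : 0 < x) (hy : 0 < y)
    (hB : ∀ t ∈ uIcc x y, t ^ (e - 1) ≤ B) : |x ^ e - y ^ e| ≤ |e| * B * |x - y| := by
  have h0 : ∀ t ∈ uIcc x y, 0 < t := fun t ht ↦ (lt_min hx hy).trans_le ht.1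
  refine (convex_uIcc x y).norm_image_sub_le_of_norm_hasDerivWithin_le (f := fun t ↦ t ^ e)
    (f' := fun t ↦ e * t ^ (e - 1))
    (fun t ht ↦ (Real.hasDerivAt_rpow_const (Or.inl (h0 t ht).ne')).hasDerivWithinAt)
    (fun t ht ↦ ?_) right_mem_uIcc left_mem_uIcc
  rw [Real.norm_eq_abs, abs_mul, abs_of_pos (Real.rpow_pos_of_pos (h0 t ht) _)]
  gcongr
  exact hB t ht

lemma norm_normalize_sub_le {E : Type*} [NormedAddCommGroup E] [NormedSpace ℝ E] {c : ℝ}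
    (hc : 0 < c) {x y : E} (hx : c ≤ ‖x‖) (hy : c ≤ ‖y‖) :
    ‖‖x‖⁻¹ • x - ‖y‖⁻¹ • y‖ ≤ 2 * (c⁻¹ * ‖x - y‖) := by
  have h1 : ∀ z : E, ‖c⁻¹ • z‖⁻¹ • c⁻¹ • z = ‖z‖⁻¹ • z := fun z ↦ by
    rw [norm_smul, norm_inv, Real.norm_eq_abs, abs_of_pos hc, smul_smul, mul_inv, inv_inv]
    congr 1
    field_simp
  have h2 : ∀ z : E, c ≤ ‖z‖ → c⁻¹ • z ∈ {z : E | 1 ≤ ‖z‖} := fun z hz ↦ by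
    rw [mem_ofPred_eq, norm_smul, norm_inv, Real.norm_eq_abs, abs_of_pos hc, ← div_eq_inv_mul,
      one_le_div hc]
    exact hz
  have h3 := lipschitzOnWith_normalize.dist_le_mul _ (h2 x hx) _ (h2 y hy)
  rw [dist_eq_norm, dist_eq_norm, h1, h1, ← smul_sub, norm_smul, norm_inv, Real.norm_eq_abs,
    abs_of_pos hc] at h3
  exact h3

lemma normalize_mem_sphere {E : Type*} [NormedAddCommGroup E] [NormedSpace ℝ E] {x : E}
    (hx : x ≠ 0) : ‖x‖⁻¹ • x ∈ sphere (0 : E) 1 := by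
  rw [mem_sphere_zero_iff_norm, norm_smul, norm_inv, norm_norm,
    inv_mul_cancel₀ (norm_ne_zero_iff.2 hx)]

lemma PosHomogeneousOn.eq_normalize {E F : Type*} [NormedAddCommGroup E] [NormedSpace ℝ E]
    [AddCommGroup F] [Module ℝ F] {a : ℝ} {Ψ : E → F} {s : Set E}
    (hΨ : PosHomogeneousOn a Ψ s) {x : E} (hx : x ≠ 0) (hs : ‖x‖⁻¹ • x ∈ s) :
    Ψ x = ‖x‖ ^ a • Ψ (‖x‖⁻¹ • x) := by
  rw [← hΨ ‖x‖ (norm_pos_iff.2 hx) _ hs, smul_smul, mul_inv_cancel₀ (norm_ne_zero_iff.2 hx),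
    one_smul]

lemma LipschitzOnSphere.exists_bound {E F : Type*} [NormedAddCommGroup E] [NormedSpace ℝ E]
    [FiniteDimensional ℝ E] [NormedAddCommGroup F] {Ψ : E → F} (h : LipschitzOnSphere Ψ) :
    ∃ M : ℝ, 0 ≤ M ∧ ∀ x ∈ sphere (0 : E) 1, ‖Ψ x‖ ≤ M := by
  obtain ⟨L, hL⟩ := h
  obtain ⟨C, hC⟩ := (isCompact_sphere (0 : E) 1).exists_bound_of_continuousOn hL.continuousOn
  exact ⟨max C 0, le_max_right _ _, fun x hx ↦ (hC x hx).trans (le_max_left _ _)⟩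

/-- A homogeneous function of degree `p > 1`, Lipschitz on the sphere. -/
theorem exists_homLipschitz {l : ℕ} {p : ℝ} (hp : 1 < p) {Φ : EuclideanSpace ℝ (Fin l) → ℝ}
    (hΦ : PosHomogeneousOn p Φ univ) (hΦL : LipschitzOnSphere Φ) :
    ∃ L, 0 ≤ L ∧ HomLipschitz L p Φ := by
  obtain ⟨M, hM, hMb⟩ := hΦL.exists_bound
  obtain ⟨L₀, hL₀⟩ := hΦL
  have hzero : Φ 0 = 0 := by
    have h := hΦ 2 two_pos 0 (mem_univ _)
    rw [smul_zero, smul_eq_mul] at h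
    have h2 : (1 : ℝ) < 2 ^ p := Real.one_lt_rpow one_lt_two (by linarith)
    have h3 : (2 ^ p - 1) * Φ 0 = 0 := by linarith
    exact (mul_eq_zero.1 h3).resolve_left (by linarith)
  set L := p * M + 2 * L₀ + M with hL
  have hL0 : 0 ≤ L := by positivity
  -- The difference splits into a radial part (constant `p M`) and an angular part (constant `2
  -- L₀`); the last `M` covers `b = 0`. The factor `‖b‖⁻¹` from projecting to the sphere is absorbed
  -- by the weight `‖b‖^p`.
  have key : ∀ a b, ‖b‖ ≤ ‖a‖ → |Φ a - Φ b| ≤ L * ‖a - b‖ * ‖a‖ ^ (p - 1) := by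
    intro a b hab
    rcases eq_or_ne b 0 with hb | hb
    · rw [hb, hzero, sub_zero, sub_zero]
      rcases eq_or_ne a 0 with ha | ha
      · rw [ha, hzero, abs_zero]; positivity
      rw [hΦ.eq_normalize ha (mem_univ _), smul_eq_mul, abs_mul, abs_of_nonneg (by positivity),
        mul_assoc, ← Real.rpow_one_add' (norm_nonneg _) (by linarith), add_sub_cancel, mul_comm]
      gcongr
      refine (hMb _ (normalize_mem_sphere ha)).trans ?_
      rw [hL]
      have : 0 ≤ p * M + 2 * L₀ := by positivity
      linarith
    · have hb0 : 0 < ‖b‖ := norm_pos_iff.2 hb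
      have ha0 : 0 < ‖a‖ := hb0.trans_le hab
      have ha : a ≠ 0 := norm_pos_iff.1 ha0
      set a' := ‖a‖⁻¹ • a
      set b' := ‖b‖⁻¹ • b
      have h1 : Φ a - Φ b = (‖a‖ ^ p - ‖b‖ ^ p) * Φ a' + ‖b‖ ^ p * (Φ a' - Φ b') := by
        rw [hΦ.eq_normalize ha (mem_univ _), hΦ.eq_normalize hb (mem_univ _), smul_eq_mul,
          smul_eq_mul]
        ring
      have h2 : |‖a‖ ^ p - ‖b‖ ^ p| ≤ p * ‖a‖ ^ (p - 1) * ‖a - b‖ := by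
        have h3 := abs_rpow_sub_rpow_le (e := p) (B := ‖a‖ ^ (p - 1)) ha0 hb0 fun t ht ↦ by
          rw [uIcc_of_ge hab] at ht
          exact Real.rpow_le_rpow (hb0.le.trans ht.1) ht.2 (by linarith)
        rw [abs_of_pos (by linarith : 0 < p)] at h3
        refine h3.trans ?_
        gcongr
        exact abs_norm_sub_norm_le a b
      have h4 : |Φ a' - Φ b'| ≤ L₀ * (2 * (‖b‖⁻¹ * ‖a - b‖)) := by
        have h5 := hL₀.dist_le_mul _ (normalize_mem_sphere ha) _ (normalize_mem_sphere hb)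
        rw [Real.dist_eq, dist_eq_norm] at h5
        refine h5.trans ?_
        gcongr
        exact norm_normalize_sub_le hb0 hab le_rfl
      have h6 : ‖b‖ ^ p * ‖b‖⁻¹ ≤ ‖a‖ ^ (p - 1) := by
        rw [← Real.rpow_neg_one, ← Real.rpow_add hb0, ← sub_eq_add_neg]
        exact Real.rpow_le_rpow hb0.le hab (by linarith)
      calc |Φ a - Φ b| ≤ |‖a‖ ^ p - ‖b‖ ^ p| * |Φ a'| + ‖b‖ ^ p * |Φ a' - Φ b'| := by
            rw [h1]
            refine (abs_add_le _ _).trans_eq ?_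
            rw [abs_mul, abs_mul, abs_of_pos (Real.rpow_pos_of_pos hb0 p)]
        _ ≤ p * ‖a‖ ^ (p - 1) * ‖a - b‖ * M + ‖b‖ ^ p * (L₀ * (2 * (‖b‖⁻¹ * ‖a - b‖))) := by
            gcongr
            exact hMb _ (normalize_mem_sphere ha)
        _ = p * M * ‖a - b‖ * ‖a‖ ^ (p - 1) + 2 * L₀ * ‖a - b‖ * (‖b‖ ^ p * ‖b‖⁻¹) := by ring
        _ ≤ p * M * ‖a - b‖ * ‖a‖ ^ (p - 1) + 2 * L₀ * ‖a - b‖ * ‖a‖ ^ (p - 1) := by gcongr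
        _ ≤ p * M * ‖a - b‖ * ‖a‖ ^ (p - 1) + 2 * L₀ * ‖a - b‖ * ‖a‖ ^ (p - 1) +
            M * ‖a - b‖ * ‖a‖ ^ (p - 1) := le_add_of_nonneg_right (by positivity)
        _ = _ := by rw [hL]; ring
  have hsub : ∀ a b, |Φ a - Φ b| ≤ L * ‖a - b‖ * (max ‖a‖ ‖b‖) ^ (p - 1) := by
    intro a b
    rcases le_total ‖b‖ ‖a‖ with h | h
    · rw [max_eq_left h]; exact key a b h
    · rw [max_eq_right h, abs_sub_comm, norm_sub_rev]; exact key b a h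
  have hcont : Continuous Φ := by
    refine continuous_iff_continuousAt.2 fun b ↦ ?_
    refine tendsto_iff_dist_tendsto_zero.2 (squeeze_zero (fun _ ↦ dist_nonneg)
      (fun a ↦ (Real.dist_eq _ _).trans_le (hsub a b)) ?_)
    have h1 : Continuous fun a ↦ L * ‖a - b‖ * (max ‖a‖ ‖b‖) ^ (p - 1) :=
      (continuous_const.mul (continuous_id.sub continuous_const).norm).mul
        ((continuous_norm.max continuous_const).rpow_const fun _ ↦ Or.inr (by linarith))
    have h2 := h1.tendsto b
    simpa using h2
  exact ⟨L, hL0, hcont.measurable, hzero, fun t ht a ↦ hΦ t ht a (mem_univ _), hsub⟩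

/-- A homogeneous kernel of degree `a < 0`, Lipschitz on the sphere. -/
theorem exists_kernel_bounds {E F : Type*} [NormedAddCommGroup E] [NormedSpace ℝ E]
    [FiniteDimensional ℝ E] [NormedAddCommGroup F] [NormedSpace ℝ F] {a : ℝ} (ha : a < 0)
    {K : E → F} (hK : PosHomogeneousOn a K {0}ᶜ) (hKL : LipschitzOnSphere K) :
    ∃ A : ℝ, 0 ≤ A ∧ ∀ r : ℝ, 0 < r → (∀ u ∈ shell E (r / 2) r, ‖K u‖ ≤ A * r ^ a) ∧
      ∀ u ∈ shell E (r / 2) r, ∀ v ∈ shell E (r / 2) r,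
        ‖K u - K v‖ ≤ A * r ^ a / r * ‖u - v‖ := by
  obtain ⟨M, hM, hMb⟩ := hKL.exists_bound
  obtain ⟨L, hL⟩ := hKL
  -- As `a < 0`, the power `‖u‖^a` on the shell is at most its value `c r^a` at the inner radius
  -- `r/2`.
  set c : ℝ := 2 ^ (-a) with hc
  have hc0 : 0 < c := by positivity
  refine ⟨c * M + (c * (4 * L) + |a| * (2 * c) * M), by positivity, fun r hr ↦ ?_⟩
  have hr2 : 0 < r / 2 := by positivity
  have hpow : (r / 2) ^ a = c * r ^ a := by
    rw [Real.div_rpow hr.le zero_le_two, hc, Real.rpow_neg zero_le_two]; field_simp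
  have hne : ∀ u ∈ shell E (r / 2) r, u ≠ 0 := fun u hu ↦ norm_pos_iff.1 (hr2.trans_le hu.1)
  have hKu : ∀ u ∈ shell E (r / 2) r, K u = ‖u‖ ^ a • K (‖u‖⁻¹ • u) := fun u hu ↦
    hK.eq_normalize (hne u hu) (ne_of_mem_sphere (normalize_mem_sphere (hne u hu)) one_ne_zero)
  have hua : ∀ u ∈ shell E (r / 2) r, ‖u‖ ^ a ≤ c * r ^ a := fun u hu ↦ by
    rw [← hpow]
    exact Real.rpow_le_rpow_of_nonpos hr2 hu.1 ha.le
  have hra : 0 < r ^ a := by positivity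
  constructor
  · intro u hu
    rw [hKu u hu, norm_smul, Real.norm_eq_abs, abs_of_nonneg (by positivity)]
    calc ‖u‖ ^ a * ‖K (‖u‖⁻¹ • u)‖ ≤ c * r ^ a * M := by
          gcongr
          · exact hua u hu
          · exact hMb _ (normalize_mem_sphere (hne u hu))
      _ = c * M * r ^ a := by ring
      _ ≤ _ := by
          gcongr
          exact le_add_of_nonneg_right (by positivity)
  · intro u hu v hv
    have h1 : K u - K v = ‖u‖ ^ a • (K (‖u‖⁻¹ • u) - K (‖v‖⁻¹ • v)) +
        (‖u‖ ^ a - ‖v‖ ^ a) • K (‖v‖⁻¹ • v) := by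
      rw [hKu u hu, hKu v hv]; module
    have h2 : ‖K (‖u‖⁻¹ • u) - K (‖v‖⁻¹ • v)‖ ≤ L * (2 * ((r / 2)⁻¹ * ‖u - v‖)) := by
      have h3 := hL.dist_le_mul _ (normalize_mem_sphere (hne u hu)) _
        (normalize_mem_sphere (hne v hv))
      rw [dist_eq_norm, dist_eq_norm] at h3
      refine h3.trans ?_
      gcongr
      exact norm_normalize_sub_le hr2 hu.1 hv.1
    have h4 : |‖u‖ ^ a - ‖v‖ ^ a| ≤ |a| * (2 * c * r ^ a / r) * ‖u - v‖ := by
      have h5 := abs_rpow_sub_rpow_le (e := a) (B := 2 * c * r ^ a / r) (hr2.trans_le hu.1)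
        (hr2.trans_le hv.1) fun t ht ↦ by
          have ht' : r / 2 ≤ t := (le_min hu.1 hv.1).trans ht.1
          refine (Real.rpow_le_rpow_of_nonpos hr2 ht' (by linarith)).trans_eq ?_
          rw [Real.rpow_sub_one hr2.ne', hpow]
          field_simp
      refine h5.trans ?_
      gcongr
      exact abs_norm_sub_norm_le u v
    calc ‖K u - K v‖ ≤ ‖u‖ ^ a * ‖K (‖u‖⁻¹ • u) - K (‖v‖⁻¹ • v)‖ +
          |‖u‖ ^ a - ‖v‖ ^ a| * ‖K (‖v‖⁻¹ • v)‖ := by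
          rw [h1]
          refine (norm_add_le _ _).trans_eq ?_
          rw [norm_smul, norm_smul, Real.norm_eq_abs, Real.norm_eq_abs,
            abs_of_nonneg (by positivity : 0 ≤ ‖u‖ ^ a)]
      _ ≤ c * r ^ a * (L * (2 * ((r / 2)⁻¹ * ‖u - v‖))) +
          |a| * (2 * c * r ^ a / r) * ‖u - v‖ * M := by
          gcongr
          · exact hua u hu
          · exact hMb _ (normalize_mem_sphere (hne v hv))
      _ = (c * (4 * L) + |a| * (2 * c) * M) * r ^ a / r * ‖u - v‖ := by field_simp; ring
      _ ≤ _ := by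
          gcongr ?_ * _ / _ * _
          exact le_add_of_nonneg_left (by positivity)

lemma continuousOn_of_homogeneous {E F : Type*} [NormedAddCommGroup E] [NormedSpace ℝ E]
    [NormedAddCommGroup F] [NormedSpace ℝ F] {a : ℝ}
    {K : E → F} (hK : PosHomogeneousOn a K {0}ᶜ) (hKL : LipschitzOnSphere K) :
    ContinuousOn K {0}ᶜ := by
  obtain ⟨L, hL⟩ := hKL
  have h1 : ContinuousOn (fun x : E ↦ ‖x‖ ^ a • K (‖x‖⁻¹ • x)) {0}ᶜ := by
    have hn : ContinuousOn (fun x : E ↦ ‖x‖) {0}ᶜ := continuous_norm.continuousOn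
    have hne : ∀ x ∈ ({0}ᶜ : Set E), ‖x‖ ≠ 0 := fun x hx ↦ norm_ne_zero_iff.2 hx
    refine (hn.rpow_const fun x hx ↦ Or.inl (hne x hx)).smul
      (hL.continuousOn.comp ((hn.inv₀ hne).smul continuousOn_id) fun x hx ↦ ?_)
    exact normalize_mem_sphere hx
  refine h1.congr fun x hx ↦ ?_
  exact hK.eq_normalize hx (ne_of_mem_sphere (normalize_mem_sphere hx) one_ne_zero)

end Homogeneous

/-! ### Verification of the hypotheses and conclusion -/

section Assembly

variable {m l : ℕ}

lemma annulusPart_eq {d l : ℕ} (K : EuclideanSpace ℝ (Fin d) → EuclideanSpace ℝ (Fin l)) (n : ℤ) :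
    annulusPart K n = (shell _ ((2 : ℝ) ^ (-n) / 2) (2 ^ (-n))).indicator K := by
  rw [annulusPart, zpow_sub_one₀ two_ne_zero]
  rfl

lemma annulusPart_neg {d l : ℕ} (K : EuclideanSpace ℝ (Fin d) → EuclideanSpace ℝ (Fin l)) (n : ℤ)
    (u : EuclideanSpace ℝ (Fin d)) : annulusPart (fun x ↦ -K x) n u = -annulusPart K n u := by
  rw [annulusPart, annulusPart]
  exact congrFun (indicator_neg' _ K) u

lemma measurable_annulusPart {d l : ℕ} {K : EuclideanSpace ℝ (Fin d) → EuclideanSpace ℝ (Fin l)}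
    (hK : ContinuousOn K {0}ᶜ) (n : ℤ) : Measurable (annulusPart K n) := by
  classical
  rw [annulusPart_eq, ← piecewise_eq_indicator]
  refine ContinuousOn.measurable_piecewise (hK.mono fun u hu ↦ ?_) continuousOn_const
    (measurableSet_shell _ _)
  exact norm_pos_iff.1 (lt_of_lt_of_le (by positivity) hu.1)

/-- Cancellation over half-spaces for the dyadic pieces of `Φ ∘ K`. -/
lemma setIntegral_half_space_comp_annulusPart {L p a : ℝ}
    {Φ : EuclideanSpace ℝ (Fin l) → ℝ} (hΦ : HomLipschitz L p Φ)
    (hap : a * p = -((m + 1 : ℕ) : ℝ))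
    {K : EuclideanSpace ℝ (Fin (m + 1)) → EuclideanSpace ℝ (Fin l)}
    (hK : PosHomogeneousOn a K {0}ᶜ) (hKL : LipschitzOnSphere K)
    {ξ : EuclideanSpace ℝ (Fin (m + 1))}
    (h0 : ∫ ζ in halfSphere ξ, Φ (K ζ) ∂(μH[(m : ℝ)]) = 0) (n : ℤ) :
    ∫ u in {u | 0 < ⟪ξ, u⟫}, Φ (annulusPart K n u) = 0 := by
  classical
  have hKc := continuousOn_of_homogeneous hK hKL
  -- The value of `K` at the origin is arbitrary; setting it to zero makes the function measurable
  -- and changes nothing on the shell or the sphere.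
  set K₀ := ({0}ᶜ : Set (EuclideanSpace ℝ (Fin (m + 1)))).indicator K with hK₀
  have hK₀m : Measurable K₀ := by
    rw [hK₀, ← piecewise_eq_indicator]
    exact hKc.measurable_piecewise continuousOn_const (measurableSet_singleton _).compl
  have hK₀eq : ∀ x, x ≠ 0 → K₀ x = K x := fun x hx ↦ indicator_of_mem (by exact hx) _
  have hr : (0 : ℝ) < 2 ^ (-n) / 2 := by positivity
  have h1 := setIntegral_half_shell_eq_zero (Ψ := fun x ↦ Φ (K₀ x)) (hΦ.measurable.comp hK₀m)
    (fun x hx ↦ ?_) hr (b := 2 ^ (-n)) ξ ?_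
  · have hm : MeasurableSet {u : EuclideanSpace ℝ (Fin (m + 1)) | 0 < ⟪ξ, u⟫} :=
      (isOpen_lt continuous_const (continuous_const.inner continuous_id)).measurableSet
    rw [← setIntegral_indicator (measurableSet_shell _ _)] at h1
    refine Eq.trans (setIntegral_congr_fun hm fun u _ ↦ ?_) h1
    simp only [annulusPart_eq]
    by_cases hu : u ∈ shell (EuclideanSpace ℝ (Fin (m + 1))) ((2 : ℝ) ^ (-n) / 2) (2 ^ (-n))
    · rw [indicator_of_mem hu, indicator_of_mem hu, hK₀eq u (norm_pos_iff.1 (hr.trans_le hu.1))]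
    · rw [indicator_of_notMem hu, indicator_of_notMem hu, hΦ.zero]
  · have hs := normalize_mem_sphere hx
    have hx0 := norm_pos_iff.2 hx
    rw [hK₀eq x hx, hK₀eq _ (ne_of_mem_sphere hs one_ne_zero),
      hK.eq_normalize hx (ne_of_mem_sphere hs one_ne_zero),
      hΦ.smul _ (Real.rpow_pos_of_pos hx0 a), ← Real.rpow_mul hx0.le, hap,
      Real.rpow_neg hx0.le, Real.rpow_natCast]
  · have hHm : MeasurableSet (halfSphere ξ) := by
      have h1 : MeasurableSet {ζ : EuclideanSpace ℝ (Fin (m + 1)) | 0 < ⟪ζ, ξ⟫} :=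
        (isOpen_lt continuous_const (continuous_id.inner continuous_const)).measurableSet
      exact isClosed_sphere.measurableSet.inter h1
    rw [← h0]
    refine setIntegral_congr_fun hHm fun ζ hζ ↦ ?_
    simp only [hK₀eq ζ (ne_of_mem_sphere hζ.1 one_ne_zero)]

/-- The convolution with an integrable function as the potential of a signed probability. -/
lemma exists_annulusConv_eq_smul_potential
    {K : EuclideanSpace ℝ (Fin (m + 1)) → EuclideanSpace ℝ (Fin l)}
    {f : EuclideanSpace ℝ (Fin (m + 1)) → ℝ} (hf : Integrable f) (hT : 0 < ∫ x, |f x|) :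
    ∃ (μ : Measure (EuclideanSpace ℝ (Fin (m + 1)))) (s : EuclideanSpace ℝ (Fin (m + 1)) → ℝ),
      μ univ ≤ 1 ∧ Measurable s ∧ (∀ y, |s y| ≤ 1) ∧ ∀ n x,
        annulusConv K n f x = (∫ x, |f x|) • potential μ s (annulusPart K n) x := by
  set T := ∫ x, |f x| with hTdef
  obtain ⟨g, hgm, hfg⟩ := hf.aestronglyMeasurable
  have hgm' := hgm.measurable
  -- The measure has density `|f| / ‖f‖₁` and `s` is the sign of `f`, both taken from a measurable
  -- representative `g`.
  let ρ : EuclideanSpace ℝ (Fin (m + 1)) → ℝ≥0 := fun x ↦ (|g x| / T).toNNReal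
  have hρ : Measurable ρ := ((hgm'.abs).div_const T).real_toNNReal
  let s : EuclideanSpace ℝ (Fin (m + 1)) → ℝ := fun x ↦ if 0 ≤ g x then 1 else -1
  have hgi : Integrable g := hf.congr hfg
  refine ⟨volume.withDensity fun x ↦ ρ x, s, ?_, ?_, ?_, ?_⟩
  · rw [withDensity_apply _ MeasurableSet.univ, Measure.restrict_univ]
    have h1 : ∫⁻ x, (ρ x : ℝ≥0∞) = ENNReal.ofReal (∫ x, |g x| / T) :=
      (ofReal_integral_eq_lintegral_ofReal (hgi.abs.div_const T)
        (Eventually.of_forall fun x ↦ by positivity)).symm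
    rw [h1, integral_div, show ∫ x, |g x| = T from
      (integral_congr_ae (hfg.mono fun x hx ↦ by simp only [hx])).symm, div_self hT.ne',
      ENNReal.ofReal_one]
  · exact Measurable.ite (measurableSet_le measurable_const hgm') measurable_const measurable_const
  · intro y
    by_cases h : 0 ≤ g y <;> simp [s, h]
  · intro n x
    rw [potential, integral_withDensity_eq_integral_smul hρ, ← integral_smul, annulusConv,
      convolution_def]
    refine integral_congr_ae (hfg.mono fun y hy ↦ ?_)
    have hρy : (ρ y : ℝ) = |g y| / T := Real.coe_toNNReal _ (by positivity)
    have h1 : T * (ρ y * s y) = f y := by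
      rw [hρy, hy]
      by_cases h : 0 ≤ g y
      · simp only [s, h, if_true, abs_of_nonneg h]; field_simp
      · simp only [s, h, if_false, abs_of_neg (not_le.1 h)]; field_simp
    simp only [ContinuousLinearMap.lsmul_apply, NNReal.smul_def, smul_smul, h1]

lemma integrable_of_memLp_top_of_hasCompactSupport {d : ℕ} {f : EuclideanSpace ℝ (Fin d) → ℝ}
    (hf : MemLp f ⊤ volume) (hfc : HasCompactSupport f) : Integrable f := by
  refine (integrableOn_iff_integrable_of_support_subset (subset_tsupport f)).1 ?_
  have : IsFiniteMeasure (volume.restrict (tsupport f)) := ⟨by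
    rw [Measure.restrict_apply_univ]; exact hfc.measure_lt_top⟩
  exact (hf.restrict _).integrable le_top

/-- The uniform bound for potentials of signed measures of total variation at most one. -/
theorem exists_tsum_potential_annulusPart_le {L p a : ℝ} (hp : 1 < p) (ha : a < 0)
    (hap : a * p = -((m + 1 : ℕ) : ℝ)) {Φ : EuclideanSpace ℝ (Fin l) → ℝ} (hL : 0 ≤ L)
    (hΦ : HomLipschitz L p Φ) {K : EuclideanSpace ℝ (Fin (m + 1)) → EuclideanSpace ℝ (Fin l)}
    (hK : PosHomogeneousOn a K {0}ᶜ) (hKL : LipschitzOnSphere K)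
    {Ω : Set (EuclideanSpace ℝ (Fin (m + 1)))} (hΩo : IsOpen Ω) (hΩb : Bornology.IsBounded Ω)
    {β : ℝ≥0} (hβ : 0 < β) (hΩ : HasC1HolderBoundary β Ω) (hcancel : HalfSphereCancellation K Φ) :
    ∃ C : ℝ≥0∞, C ≠ ⊤ ∧ ∀ (μ : Measure (EuclideanSpace ℝ (Fin (m + 1))))
      (s : EuclideanSpace ℝ (Fin (m + 1)) → ℝ), μ univ ≤ 1 → Measurable s → (∀ y, |s y| ≤ 1) →
      (∀ n, IntegrableOn (fun x ↦ Φ (potential μ s (annulusPart K n) x)) Ω) ∧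
      ∑' n, ‖∫ x in Ω, Φ (potential μ s (annulusPart K n) x)‖ₑ ≤ C := by
  obtain ⟨A, hA, hAb⟩ := exists_kernel_bounds ha hK hKL
  have hKc := continuousOn_of_homogeneous hK hKL
  have hr : ∀ n : ℤ, (0 : ℝ) < 2 ^ (-n) := fun n ↦ by positivity
  set M : ℤ → ℝ := fun n ↦ A * (2 ^ (-n)) ^ a with hM
  have hM0 : ∀ n, 0 ≤ M n := fun n ↦ by positivity
  -- The critical scaling `a p = -d`: the `p`-th power of the kernel bound, multiplied by the volume
  -- scale `r^d`, is independent of `n`.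
  have hMp : ∀ n, M n ^ p = A ^ p / (2 ^ (-n)) ^ (m + 1) := fun n ↦ by
    rw [hM, Real.mul_rpow hA (by positivity), ← Real.rpow_mul (hr n).le, hap,
      Real.rpow_neg (hr n).le, Real.rpow_natCast]
    rfl
  have hkm : ∀ n, Measurable (annulusPart K n) := measurable_annulusPart hKc
  have hkM : ∀ n u, ‖annulusPart K n u‖ ≤ M n := fun n u ↦ by
    rw [annulusPart_eq]
    by_cases hu : u ∈ shell (EuclideanSpace ℝ (Fin (m + 1))) ((2 : ℝ) ^ (-n) / 2) (2 ^ (-n))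
    · rw [indicator_of_mem hu]; exact (hAb _ (hr n)).1 u hu
    · rw [indicator_of_notMem hu, norm_zero]; exact hM0 n
  have hkr : ∀ n u, (2 : ℝ) ^ (-n) ≤ ‖u‖ → annulusPart K n u = 0 := fun n u hu ↦ by
    rw [annulusPart_eq]
    exact indicator_of_notMem (fun h ↦ not_lt.2 hu h.2) _
  have hω := unitVol_nonneg (m + 1)
  have hmod : ∀ n y z, ∫⁻ x, ‖annulusPart K n (x - y) - annulusPart K n (x - z)‖ₑ ≤
      ENNReal.ofReal (unitVol (m + 1) * (4 * m + 5) * M n * (2 ^ (-n)) ^ m * dist y z) :=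
    fun n y z ↦ by
      rw [annulusPart_eq]
      exact lintegral_shell_indicator_sub_le (hM0 n) (hr n) (hAb _ (hr n)).1 (hAb _ (hr n)).2 y z
  have hdim : ((m + 1 : ℕ) : ℝ) - 1 = m := by push_cast; ring
  have hhalf := hcancel
  unfold HalfSphereCancellation at hhalf
  rw [hdim] at hhalf
  have hKn : PosHomogeneousOn a (fun x ↦ -K x) {0}ᶜ := fun t ht y hy ↦ by
    simp only [hK t ht y hy, smul_neg]
  have hKLn : LipschitzOnSphere (fun x ↦ -K x) := by
    obtain ⟨L₁, hL₁⟩ := hKL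
    exact ⟨L₁, fun x hx y hy ↦ by rw [edist_neg_neg]; exact hL₁ hx hy⟩
  have hqb : ∀ n (w : EuclideanSpace ℝ (Fin l)), ‖w‖ ≤ M n →
      |Φ w| ≤ L * A ^ p / (2 ^ (-n)) ^ (m + 1) := fun n w hw ↦ by
    refine (hΦ.abs_le hp w).trans ?_
    rw [mul_div_assoc, ← hMp]
    gcongr
  obtain ⟨C₁, hC₁, h₁⟩ := exists_tsum_enorm_setIntegral_translate_le
    (q := fun n u ↦ Φ (annulusPart K n u)) (A := L * A ^ p) (fun n ↦ hΦ.measurable.comp (hkm n))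
    (fun n u ↦ hqb n _ (hkM n u)) (fun n u hu ↦ by rw [hkr n u hu, hΦ.zero])
    (fun n ν hν ↦ setIntegral_half_space_comp_annulusPart hΦ hap hK hKL
      (hhalf ν (mem_sphere_zero_iff_norm.2 hν)).1 n) hΩo hΩb hβ hΩ
  obtain ⟨C₂, hC₂, h₂⟩ := exists_tsum_enorm_setIntegral_translate_le
    (q := fun n u ↦ Φ (-annulusPart K n u)) (A := L * A ^ p)
    (fun n ↦ hΦ.measurable.comp (hkm n).neg)
    (fun n u ↦ hqb n _ (by rw [norm_neg]; exact hkM n u))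
    (fun n u hu ↦ by rw [hkr n u hu, neg_zero, hΦ.zero])
    (fun n ν hν ↦ by
      have := setIntegral_half_space_comp_annulusPart hΦ hap hKn hKLn
        (hhalf ν (mem_sphere_zero_iff_norm.2 hν)).2 n
      simpa only [annulusPart_neg] using this) hΩo hΩb hβ hΩ
  have hΩf : volume Ω ≠ ⊤ := hΩb.measure_lt_top.ne
  obtain ⟨C, hC, h⟩ := exists_tsum_enorm_setIntegral_potential_le hΦ hp hL
    (B := unitVol (m + 1) * (4 * m + 5)) (by positivity) (A := A ^ p) hM0
    (fun n ↦ by rw [hMp]; exact (div_mul_cancel₀ _ (by positivity)).le) hkm hkM hkr hmod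
    hΩo.measurableSet hΩf (ENNReal.add_ne_top.2 ⟨hC₁, hC₂⟩) (fun z ↦ by
      rw [ENNReal.tsum_add]; exact add_le_add (h₁ z) (h₂ z))
  refine ⟨C, hC, fun μ s hμ hs hs1 ↦ ⟨fun n ↦ ?_, h μ s hμ hs hs1⟩⟩
  have : IsFiniteMeasure μ := ⟨hμ.trans_lt ENNReal.one_lt_top⟩
  exact integrableOn_comp_potential hΦ hp hL (hM0 n) hs hs1 (hkm n) (hkM n) (hkr n) hΩf

end Assembly

end MazyaPhi

theorem mainTheorem3 (d l : ℕ) (α p : ℝ) (β : ℝ≥0)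
    (hα : 0 < α) (hαd : α < d) (hp : p = d / (d - α)) (hβ : 0 < β) (hβ1 : β < 1)
    (K : EuclideanSpace ℝ (Fin d) → EuclideanSpace ℝ (Fin l))
    (hK : MazyaPhi.PosHomogeneousOn (α - d) K {0}ᶜ) (hKL : MazyaPhi.LipschitzOnSphere K)
    (Φ : EuclideanSpace ℝ (Fin l) → ℝ)
    (hΦ : MazyaPhi.PosHomogeneousOn p Φ Set.univ) (hΦL : MazyaPhi.LipschitzOnSphere Φ)
    (Ω : Set (EuclideanSpace ℝ (Fin d))) (hΩo : IsOpen Ω) (hΩb : Bornology.IsBounded Ω)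
    (hΩ : MazyaPhi.HasC1HolderBoundary β Ω)
    (hcancel : MazyaPhi.HalfSphereCancellation K Φ) :
    ∃ C : ℝ, ∀ f : EuclideanSpace ℝ (Fin d) → ℝ, MemLp f ⊤ volume → HasCompactSupport f →
      (∀ n : ℤ, IntegrableOn (fun x ↦ Φ (MazyaPhi.annulusConv K n f x)) Ω volume) ∧
      Summable (fun n : ℤ ↦ |∫ x in Ω, Φ (MazyaPhi.annulusConv K n f x)|) ∧
      ∑' n : ℤ, |∫ x in Ω, Φ (MazyaPhi.annulusConv K n f x)| ≤ C * (∫ x, |f x|) ^ p := by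
  obtain ⟨m, rfl⟩ : ∃ m, d = m + 1 := Nat.exists_eq_succ_of_ne_zero fun h ↦ by
    rw [h, Nat.cast_zero] at hαd; linarith
  have hpos : 0 < ((m + 1 : ℕ) : ℝ) - α := by linarith
  have hp1 : 1 < p := by rw [hp, one_lt_div hpos]; linarith
  have hap : (α - ((m + 1 : ℕ) : ℝ)) * p = -((m + 1 : ℕ) : ℝ) := by
    rw [hp]; field_simp; ring
  obtain ⟨L, hL, hΦ'⟩ := MazyaPhi.exists_homLipschitz hp1 hΦ hΦL
  obtain ⟨C, hC, h⟩ := MazyaPhi.exists_tsum_potential_annulusPart_le hp1 (by linarith) hap hL hΦ'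
    hK hKL hΩo hΩb hβ hΩ hcancel
  refine ⟨C.toReal, fun f hf hfc ↦ ?_⟩
  have hfi := MazyaPhi.integrable_of_memLp_top_of_hasCompactSupport hf hfc
  -- Normalizing divides by `‖f‖₁`, so `f = 0` almost everywhere is treated apart; otherwise
  -- `p`-homogeneity of `Φ` extracts the factor `‖f‖₁^p`.
  rcases (integral_nonneg fun x ↦ abs_nonneg (f x) : 0 ≤ ∫ x, |f x|).eq_or_lt with hT | hT
  · have hf0 : f =ᵐ[volume] 0 := by
      have := (integral_eq_zero_iff_of_nonneg (fun x ↦ abs_nonneg (f x)) hfi.abs).1 hT.symm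
      exact this.mono fun x hx ↦ abs_eq_zero.1 hx
    have hconv : ∀ n x, Φ (MazyaPhi.annulusConv K n f x) = 0 := fun n x ↦ by
      rw [MazyaPhi.annulusConv, convolution_def, integral_eq_zero_of_ae, hΦ'.zero]
      exact hf0.mono fun y hy ↦ by simp [hy]
    simp only [hconv, integral_zero, abs_zero, tsum_zero]
    exact ⟨fun n ↦ integrableOn_zero, summable_zero, by positivity⟩
  · obtain ⟨μ, s, hμ, hs, hs1, hconv⟩ :=
      MazyaPhi.exists_annulusConv_eq_smul_potential (K := K) hfi hT
    obtain ⟨hint, hsum⟩ := h μ s hμ hs hs1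
    set T := ∫ x, |f x|
    have hconv' : ∀ n x, Φ (MazyaPhi.annulusConv K n f x) =
        T ^ p * Φ (MazyaPhi.potential μ s (MazyaPhi.annulusPart K n) x) := fun n x ↦ by
      rw [hconv, hΦ'.smul T hT]
    have hTp : 0 ≤ T ^ p := by positivity
    have habs : ∀ n, |∫ x in Ω, Φ (MazyaPhi.annulusConv K n f x)| =
        T ^ p * ‖∫ x in Ω, Φ (MazyaPhi.potential μ s (MazyaPhi.annulusPart K n) x)‖ₑ.toReal :=
      fun n ↦ by
        simp only [hconv']
        rw [integral_const_mul, abs_mul, abs_of_nonneg hTp, toReal_enorm, Real.norm_eq_abs]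
    have hne := ne_top_of_le_ne_top hC hsum
    refine ⟨fun n ↦ ?_, ?_, ?_⟩
    · simp only [hconv']
      exact (hint n).const_mul _
    · simp only [habs]
      exact (ENNReal.summable_toReal hne).mul_left _
    · simp only [habs]
      rw [tsum_mul_left, mul_comm, ← ENNReal.tsum_toReal_eq fun n ↦ enorm_ne_top]
      gcongr
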